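/- Let $S=\mathbb{C}[x_1,\dots,x_n]$ and let $T=\mathbb{C}[[y_1,\dots,y_n]]$ act on $S$ with $y_i$ acting as $\partial/\partial x_i$; write $\sigma\lrcorner f$ for this action. For nonzero $f\in S$ put $f^\perp=\{\sigma\in T:\sigma\lrcorner f=0\}$; the apolar algebra of $f$ is $A_f=T/f^\perp$, a finite local Gorenstein $\mathbb{C}$-algebra. Let $A$ be a finite local Gorenstein $\mathbb{C}$-algebra with residue field $\mathbb{C}$, maximal ideal $\mathfrak m$ and socle degree $j=\max\{l:\mathfrak m^l\neq0\}$. For integers $a,b\ge 0$ put $A_{a,b}=\mathfrak m^a\cap(0:\mathfrak m^b)$, with $A_{a,-1}=0$, and $Q_{a,b}=A_{a,b}/(A_{a+1,b}+A_{a,b-1})$. The Hilbert function decomposition of $A$ is given by $\Delta_s(t)=\dim_{\mathbb{C}}Q_{t,\,j+1-(s+t)}$ for $0\le s\le j$, $0\le t\le j-s$, and $\Delta_s(t)=0$ otherwise. Put $e(i)=\sum_{t=0}^{i}\Delta_t(1)$. A polynomial $g\in S$ whose apolar algebra has socle degree $j\ge2$ is in standard form if $g=g_2+g_3+\dots+g_j$,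 where each $g_i$ is homogeneous of degree $i$ and lies in $\mathbb{C}[x_1,\dots,x_{e(j-i)}]$, with $e$ computed for $A_g$. Proposition. Let $f\in S$ be a polynomial of degree $j\ge2$, and let $q=\Delta_{j-2}(1)$ for the Hilbert function decomposition of $A_f$ (so for $j\geq 3$ the row is $\Delta_{j-2}=(0,q,0)$, and for $j=2$ it is $(1,q,1)$). Then there is a polynomial $g=g_j+g_{j-1}+\dots+g_2\in S$ of degree $j$ in standard form such that $A_f\cong A_g$ as $\mathbb{C}$-algebras and $$g_2=\sum_{x\in W}x^2+Q,$$ where $W$ is a set of exactly $q$ of the variables $x_1,\dots,x_n$, none of which appears in $g_{\ge3}=g_3+\dots+g_j$, and $Q$ is a quadratic form (possibly zero) in variables that appear in $g_{\ge3}$. -/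

import Mathlib

namespace Apolarity

section Action

variable {k : Type*} [Field k] {n : ℕ}

/-- The action `σ ⌟ f` of the power series ring `k⟦y₁, …, yₙ⟧` on the polynomial ring
`k[x₁, …, xₙ]` in which `yᵢ` acts as `∂/∂xᵢ`.  On a monomial it reads
`σ ⌟ x^γ = ∑_{α + β = γ} σ_α · (∂^α x^γ)`, where
`∂^α x^γ = (∏ᵢ γᵢ (γᵢ - 1) ⋯ (γᵢ - αᵢ + 1)) x^β`. -/
noncomputable def contract (σ : MvPowerSeries (Fin n) k) :
    MvPolynomial (Fin n) k →ₗ[k] MvPolynomial (Fin n) k :=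
  (MvPolynomial.basisMonomials (Fin n) k).constr k fun γ =>
    ∑ p ∈ Finset.HasAntidiagonal.antidiagonal γ,
      MvPolynomial.monomial p.2
        (MvPowerSeries.coeff p.1 σ * ((∏ i, (γ i).descFactorial (p.1 i) : ℕ) : k))

theorem contract_monomial_one (σ : MvPowerSeries (Fin n) k) (γ : Fin n →₀ ℕ) :
    contract σ (MvPolynomial.monomial γ 1) = ∑ p ∈ Finset.HasAntidiagonal.antidiagonal γ,
      MvPolynomial.monomial p.2
        (MvPowerSeries.coeff p.1 σ * ((∏ i, (γ i).descFactorial (p.1 i) : ℕ) : k)) := by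
  have h := (MvPolynomial.basisMonomials (Fin n) k).constr_basis k (fun γ =>
    ∑ p ∈ Finset.HasAntidiagonal.antidiagonal γ,
      MvPolynomial.monomial p.2
        (MvPowerSeries.coeff p.1 σ * ((∏ i, (γ i).descFactorial (p.1 i) : ℕ) : k))) γ
  rw [MvPolynomial.coe_basisMonomials] at h
  exact h

theorem contract_add (σ τ : MvPowerSeries (Fin n) k) :
    contract (σ + τ) = contract σ + contract τ := by
  refine (MvPolynomial.basisMonomials (Fin n) k).ext fun γ => ?_
  simp only [MvPolynomial.coe_basisMonomials, LinearMap.add_apply, contract_monomial_one,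
    map_add, add_mul, Finset.sum_add_distrib]

theorem descFactorial_split (u v b : ℕ) :
    (v + (u + b)).descFactorial (u + v) =
      (v + (u + b)).descFactorial v * (u + b).descFactorial u := by
  induction u generalizing b v with
  | zero => simp
  | succ u ih =>
    have h1 : v + (u + 1 + b) = v + (u + (b + 1)) := by omega
    have h2 : u + 1 + b = u + (b + 1) := by omega
    have h3 : u + 1 + v = (u + v) + 1 := by omega
    rw [h1, h2, h3, Nat.descFactorial_succ, Nat.descFactorial_succ, ih]
    have h4 : v + (u + (b + 1)) - (u + v) = b + 1 := by omega
    have h5 : u + (b + 1) - u = b + 1 := by omega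
    rw [h4, h5]
    ring

theorem contract_mul (σ τ : MvPowerSeries (Fin n) k) :
    contract (σ * τ) = contract σ ∘ₗ contract τ := by
  refine (MvPolynomial.basisMonomials (Fin n) k).ext fun γ => ?_
  have key : ∀ (β : Fin n →₀ ℕ) (c : k), contract σ (MvPolynomial.monomial β c) =
      ∑ p ∈ Finset.HasAntidiagonal.antidiagonal β, MvPolynomial.monomial p.2
        (c * (MvPowerSeries.coeff p.1 σ *
          ((∏ i, (β i).descFactorial (p.1 i) : ℕ) : k))) := by
    intro β c
    have : MvPolynomial.monomial β c = c • MvPolynomial.monomial β (1 : k) := by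
      rw [MvPolynomial.smul_monomial, smul_eq_mul, mul_one]
    rw [this, map_smul, contract_monomial_one, Finset.smul_sum]
    simp only [MvPolynomial.smul_monomial, smul_eq_mul]
  simp only [MvPolynomial.coe_basisMonomials, LinearMap.comp_apply, contract_monomial_one,
    map_sum, key, MvPowerSeries.coeff_mul, Finset.sum_mul]
  rw [Finset.sum_sigma', Finset.sum_sigma']
  refine Finset.sum_bij'
    (fun x _ => ⟨(x.2.2, x.2.1 + x.1.2), (x.2.1, x.1.2)⟩)
    (fun x _ => ⟨(x.2.1 + x.1.1, x.2.2), (x.2.1, x.1.1)⟩) ?_ ?_ ?_ ?_ ?_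
  · rintro ⟨⟨a, b⟩, ⟨u, v⟩⟩ h
    simp only [Finset.mem_sigma, Finset.HasAntidiagonal.mem_antidiagonal] at h ⊢
    obtain ⟨rfl, rfl⟩ := h
    exact ⟨by abel, trivial⟩
  · rintro ⟨⟨v, w⟩, ⟨u, b⟩⟩ h
    simp only [Finset.mem_sigma, Finset.HasAntidiagonal.mem_antidiagonal] at h ⊢
    obtain ⟨rfl, rfl⟩ := h
    exact ⟨by abel, trivial⟩
  · rintro ⟨⟨a, b⟩, ⟨u, v⟩⟩ h
    simp only [Finset.mem_sigma, Finset.HasAntidiagonal.mem_antidiagonal] at h ⊢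
    obtain ⟨rfl, rfl⟩ := h
    rfl
  · rintro ⟨⟨v, w⟩, ⟨u, b⟩⟩ h
    simp only [Finset.mem_sigma, Finset.HasAntidiagonal.mem_antidiagonal] at h ⊢
    obtain ⟨rfl, rfl⟩ := h
    rfl
  · rintro ⟨⟨a, b⟩, ⟨u, v⟩⟩ h
    simp only [Finset.mem_sigma, Finset.HasAntidiagonal.mem_antidiagonal] at h ⊢
    obtain ⟨rfl, rfl⟩ := h
    congr 1
    have : (∏ i, ((u + v + b) i).descFactorial ((u + v) i)) =
        (∏ i, ((u + v + b) i).descFactorial (v i)) *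
          ∏ i, ((u + b) i).descFactorial (u i) := by
      rw [← Finset.prod_mul_distrib]
      refine Finset.prod_congr rfl fun i _ => ?_
      have h1 : (u + v + b) i = v i + (u i + b i) := by
        simp only [Finsupp.add_apply]; omega
      rw [h1, Finsupp.add_apply, Finsupp.add_apply]
      exact descFactorial_split _ _ _
    rw [this]
    push_cast
    ring

/-- The variable `yᵢ` acts as the partial derivative `∂/∂xᵢ`. -/
theorem contract_X (i : Fin n) (f : MvPolynomial (Fin n) k) :
    contract (MvPowerSeries.X i) f = MvPolynomial.pderiv i f := by
  have : contract (MvPowerSeries.X i) =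
      ((MvPolynomial.pderiv i : Derivation k _ _) :
        MvPolynomial (Fin n) k →ₗ[k] MvPolynomial (Fin n) k) := by
    refine (MvPolynomial.basisMonomials (Fin n) k).ext fun γ => ?_
    simp only [MvPolynomial.coe_basisMonomials, contract_monomial_one, Derivation.coeFn_coe,
      MvPolynomial.pderiv_monomial, MvPowerSeries.coeff_X]
    by_cases hγ : γ i = 0
    · rw [hγ]
      simp only [Nat.cast_zero, mul_zero, map_zero]
      refine Finset.sum_eq_zero ?_
      rintro ⟨a, b⟩ h
      simp only [Finset.HasAntidiagonal.mem_antidiagonal] at h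
      subst h
      have ha : a ≠ Finsupp.single i 1 := by
        rintro rfl
        simp at hγ
      simp [ha]
    · rw [Finset.sum_eq_single (Finsupp.single i 1, γ - Finsupp.single i 1)]
      · simp only [if_true, one_mul]
        congr 1
        rw [Finset.prod_eq_single i]
        · simp
        · intro b _ hb
          simp [hb.symm]
        · simp
      · rintro ⟨a, b⟩ h hne
        simp only [Finset.HasAntidiagonal.mem_antidiagonal] at h
        subst h
        have ha : a ≠ Finsupp.single i 1 := by
          rintro rfl
          simp at hne
        simp [ha]
      · intro h
        exfalso
        apply h
        simp only [Finset.HasAntidiagonal.mem_antidiagonal]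
        refine add_tsub_cancel_of_le ?_
        rw [Finsupp.single_le_iff]
        omega
  rw [this]
  rfl

/-- The ideal `f^⊥` of all power series `σ` with `σ ⌟ f = 0`. -/
noncomputable def perp (f : MvPolynomial (Fin n) k) : Ideal (MvPowerSeries (Fin n) k) where
  carrier := {σ | contract σ f = 0}
  add_mem' {σ τ} hσ hτ := by
    simp only [Set.mem_ofPred_eq] at hσ hτ ⊢
    rw [contract_add, LinearMap.add_apply, hσ, hτ, add_zero]
  zero_mem' := by
    have h := contract_add (0 : MvPowerSeries (Fin n) k) 0
    rw [add_zero] at h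
    simp only [Set.mem_ofPred_eq, left_eq_add.mp h, LinearMap.zero_apply]
  smul_mem' σ τ hτ := by
    simp only [Set.mem_ofPred_eq] at hτ ⊢
    rw [smul_eq_mul, contract_mul, LinearMap.comp_apply, hτ, map_zero]

/-- The apolar algebra `k⟦y₁, …, yₙ⟧ / f^⊥` of `f`. -/
abbrev ApolarAlgebra (f : MvPolynomial (Fin n) k) : Type _ :=
  MvPowerSeries (Fin n) k ⧸ perp f

/-- The image in the apolar algebra of the maximal ideal of the power series ring; for `f ≠ 0`
this is the unique maximal ideal of the (local) apolar algebra. -/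
noncomputable def apolarMax (f : MvPolynomial (Fin n) k) : Ideal (ApolarAlgebra f) :=
  (IsLocalRing.maximalIdeal (MvPowerSeries (Fin n) k)).map (Ideal.Quotient.mk (perp f))

theorem perp_ne_top {f : MvPolynomial (Fin n) k} (hf : f ≠ 0) : perp f ≠ ⊤ := by
  intro h
  apply hf
  have h1 : contract (1 : MvPowerSeries (Fin n) k) f = 0 := by
    have : (1 : MvPowerSeries (Fin n) k) ∈ perp f := h ▸ Submodule.mem_top
    exact this
  have h2 : contract (1 : MvPowerSeries (Fin n) k) = LinearMap.id := by
    refine (MvPolynomial.basisMonomials (Fin n) k).ext fun γ => ?_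
    simp only [MvPolynomial.coe_basisMonomials, contract_monomial_one, LinearMap.id_apply]
    rw [Finset.sum_eq_single ((0 : Fin n →₀ ℕ), γ)]
    · simp
    · rintro ⟨a, b⟩ h hne
      simp only [Finset.HasAntidiagonal.mem_antidiagonal] at h
      subst h
      have ha : a ≠ 0 := by
        rintro rfl
        simp at hne
      simp [MvPowerSeries.coeff_one, ha]
    · simp
  rw [h2] at h1
  exact h1

theorem apolar_isLocalRing {f : MvPolynomial (Fin n) k} (hf : f ≠ 0) :
    IsLocalRing (ApolarAlgebra f) := by
  have : Nontrivial (ApolarAlgebra f) := Ideal.Quotient.nontrivial_iff.mpr (perp_ne_top hf)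
  exact IsLocalRing.of_surjective' (Ideal.Quotient.mk (perp f)) Ideal.Quotient.mk_surjective

theorem eq_apolarMax_of_isMaximal {f : MvPolynomial (Fin n) k}
    (M : Ideal (ApolarAlgebra f)) (hM : M.IsMaximal) : M = apolarMax f := by
  have h := IsLocalRing.eq_maximalIdeal
    (Ideal.comap_isMaximal_of_surjective (Ideal.Quotient.mk (perp f))
      Ideal.Quotient.mk_surjective (K := M))
  rw [apolarMax, ← h, Ideal.map_comap_of_surjective _ Ideal.Quotient.mk_surjective]

end Action

section Decomposition

/-! Invariants of a finite local `k`-algebra `A` with maximal ideal `𝔪`. -/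

variable (k : Type*) [Field k] {A : Type*} [CommRing A] [Algebra k A]

/-- The socle degree: the largest `l` with `𝔪 ^ l ≠ 0`. -/
noncomputable def socleDegree (𝔪 : Ideal A) : ℕ := sSup {l : ℕ | 𝔪 ^ l ≠ ⊥}

/-- The ideal `A_{a,b} = 𝔪 ^ a ∩ (0 : 𝔪 ^ b)`. -/
noncomputable def loewyIdeal (𝔪 : Ideal A) (a b : ℕ) : Ideal A :=
  𝔪 ^ a ⊓ Module.annihilator A ↥(𝔪 ^ b)

/-- The `k`-rank of `Q_{a,b} = A_{a,b} / (A_{a+1,b} + A_{a,b-1})`.  For `b = 0` one has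
`A_{a,-1} = A_{a,0} = 0`, in agreement with truncated subtraction. -/
noncomputable def rankQ (𝔪 : Ideal A) (a b : ℕ) : ℕ :=
  Module.finrank k (↥(loewyIdeal 𝔪 a b) ⧸
    (loewyIdeal 𝔪 (a + 1) b ⊔ loewyIdeal 𝔪 a (b - 1)).submoduleOf (loewyIdeal 𝔪 a b))

/-- The Hilbert function decomposition: `Δ_s(t) = rk Q_{t, j+1-(s+t)}` for `0 ≤ s ≤ j` and
`0 ≤ t ≤ j - s`, and `0` otherwise, where `j` is the socle degree. -/
noncomputable def hilbertDecomp (𝔪 : Ideal A) (s t : ℕ) : ℕ :=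
  if s + t ≤ socleDegree 𝔪 then rankQ k 𝔪 t (socleDegree 𝔪 + 1 - (s + t)) else 0

/-- `e(i) = ∑_{t=0}^{i} Δ_t(1)`. -/
noncomputable def embCount (𝔪 : Ideal A) (i : ℕ) : ℕ :=
  ∑ t ∈ Finset.range (i + 1), hilbertDecomp k 𝔪 t 1

end Decomposition

section StandardForm

variable {k : Type*} [Field k] {n : ℕ}

/-- The rows `Δ_s` of the Hilbert function decomposition of the apolar algebra of `f`. -/
noncomputable def apolarDecomp (f : MvPolynomial (Fin n) k) (s t : ℕ) : ℕ :=
  hilbertDecomp k (apolarMax f) s t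

/-- `g` is in the standard form: with `j` the socle degree of its apolar algebra,
`g = g₀ + ⋯ + g_j` with `gᵢ` homogeneous of degree `i` in the first `e(j - i)` variables, and
`g₀ = g₁ = 0` unless `j ≤ 1`. -/
def IsStandardForm (g : MvPolynomial (Fin n) k) : Prop :=
  g.totalDegree ≤ socleDegree (apolarMax g) ∧
  (∀ i ≤ socleDegree (apolarMax g), ∀ l ∈ (MvPolynomial.homogeneousComponent i g).vars,
    (l : ℕ) < embCount k (apolarMax g) (socleDegree (apolarMax g) - i)) ∧
  (socleDegree (apolarMax g) ≤ 1 ∨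
    (MvPolynomial.homogeneousComponent 0 g = 0 ∧ MvPolynomial.homogeneousComponent 1 g = 0))

/-- `g_{≥ d}`: the sum of the homogeneous components of `g` of degree at least `d`. -/
noncomputable def componentsGE (d : ℕ) (g : MvPolynomial (Fin n) k) : MvPolynomial (Fin n) k :=
  ∑ i ∈ Finset.Icc d g.totalDegree, MvPolynomial.homogeneousComponent i g

end StandardForm

end Apolarity

/-! Write `A` for the apolar algebra of `f`, `𝔪` for its maximal ideal and `φ₀` for the functional
sending the class of `σ` to the constant term of `σ ⌟ f`; in characteristic zero its kernel contains
no nonzero ideal. By Macaulay's correspondence (`nonempty_algEquiv_dualPolynomial`), elements `z₁,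
…, zₙ` that generate `𝔪`, together with any such functional `φ`, present `A` as the apolar algebra
of `∑ φ(z^γ) x^γ / γ!`. The theorem thus becomes a choice of `z` and `φ`, with no change of
coordinates in `f` itself.

The choice of `z` is made in `𝔪/𝔪²`, filtered by the images of the annihilators `(0 : 𝔪^b)`. The
numbers `Δ_s(1)` are the dimensions of the graded pieces, and `e(j - i)` is the codimension of the
image of `(0 : 𝔪^(i-1))` (`embCount_add_finrank`). If the late generators lie in the small
annihilators, a generator of index at least `e(j - i)` kills `𝔪^(i-1)`, so its variable is absent
from degree `i`: this is the standard form.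

The integer `q` is the dimension of a complement `C` of `𝔪² ∩ (0 : 𝔪²)` in `𝔪 ∩ (0 : 𝔪²)`. By the
double annihilator property the form `φ₀(xy)` is nondegenerate on `C`, so `C` has an orthogonal
basis with all norms `2`, and `𝔪` splits as `C` plus its orthogonal (`exists_isAdapted`). The basis
of `C` produces the `q` squares; it kills `𝔪²`, so its variables do not occur in degree at least
`3`. The other nonzero generators do not kill `𝔪²`, and their variables do occur there.

Finally `φ₀` may be changed outside `𝔪²` without losing nondegeneracy (`nondegenerate_of_eqOn_sq`),
which removes the constant and linear terms. -/

namespace Apolarity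

/-! ### The pairing of power series with polynomials, and basic structure of the apolar algebra. -/

section Pairing

open Finsupp

variable {k : Type*} [Field k] {n : ℕ}

/-- The constant term of `σ ⌟ f` is `∑ γ, γ! σ_γ f_γ`. -/
theorem constantCoeff_contract (σ : MvPowerSeries (Fin n) k) (f : MvPolynomial (Fin n) k) :
    MvPolynomial.constantCoeff (contract σ f) = ∑ γ ∈ f.support,
      f.coeff γ * (MvPowerSeries.coeff γ σ * ((∏ i, (γ i).factorial : ℕ) : k)) := by
  conv_lhs => rw [f.as_sum]
  rw [map_sum, map_sum]
  refine Finset.sum_congr rfl fun γ _ => ?_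
  have : MvPolynomial.monomial γ (f.coeff γ) =
      f.coeff γ • MvPolynomial.monomial γ (1 : k) := by
    rw [MvPolynomial.smul_monomial, smul_eq_mul, mul_one]
  rw [this, map_smul, MvPolynomial.smul_eq_C_mul, map_mul, MvPolynomial.constantCoeff_C,
    contract_monomial_one, map_sum, Finset.sum_eq_single (γ, 0)]
  · simp [Nat.descFactorial_self]
  · rintro ⟨a, b⟩ h hne
    simp only [Finset.HasAntidiagonal.mem_antidiagonal] at h
    subst h
    have hb : b ≠ 0 := by
      rintro rfl
      simp at hne
    simp [MvPolynomial.constantCoeff_monomial, hb]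
  · simp

theorem constantCoeff_contract_of_support_subset (σ : MvPowerSeries (Fin n) k)
    (f : MvPolynomial (Fin n) k) {s : Finset (Fin n →₀ ℕ)} (hs : f.support ⊆ s) :
    MvPolynomial.constantCoeff (contract σ f) = ∑ γ ∈ s,
      f.coeff γ * (MvPowerSeries.coeff γ σ * ((∏ i, (γ i).factorial : ℕ) : k)) := by
  rw [constantCoeff_contract]
  refine Finset.sum_subset hs fun γ _ hγ => ?_
  rw [MvPolynomial.notMem_support_iff.mp hγ, zero_mul]

theorem constantCoeff_contract_monomial (γ : Fin n →₀ ℕ) (f : MvPolynomial (Fin n) k) :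
    MvPolynomial.constantCoeff (contract (MvPowerSeries.monomial γ 1) f) =
      f.coeff γ * ((∏ i, (γ i).factorial : ℕ) : k) := by
  classical
  rw [constantCoeff_contract_of_support_subset _ _ (Finset.subset_insert γ f.support),
    Finset.sum_eq_single γ]
  · simp
  · intro b _ hb
    simp [MvPowerSeries.coeff_monomial, hb]
  · simp

theorem prod_factorial_ne_zero [CharZero k] (γ : Fin n →₀ ℕ) : ((∏ i, (γ i).factorial : ℕ) : k) ≠ 0 := by
  rw [Nat.cast_ne_zero]
  exact Finset.prod_ne_zero_iff.mpr fun i _ => Nat.factorial_ne_zero _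

/-- Testing against the monomial `y^γ` reads off the coefficient of `x^γ` in `σ ⌟ f` up to the
factor `γ!`, which is invertible in characteristic zero. Hence `perp f` is the largest ideal on
which the constant-term functional vanishes. -/
theorem contract_eq_zero_iff [CharZero k] (σ : MvPowerSeries (Fin n) k) (f : MvPolynomial (Fin n) k) :
    contract σ f = 0 ↔ ∀ τ, MvPolynomial.constantCoeff (contract (τ * σ) f) = 0 := by
  refine ⟨fun h τ => by rw [contract_mul, LinearMap.comp_apply, h, map_zero, map_zero],
    fun h => ?_⟩
  ext γ
  have := h (MvPowerSeries.monomial γ 1)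
  rw [contract_mul, LinearMap.comp_apply, constantCoeff_contract_monomial] at this
  simpa using (mul_eq_zero.mp this).resolve_right (prod_factorial_ne_zero γ)

theorem contract_eq_zero_of_lt_order [CharZero k] {σ : MvPowerSeries (Fin n) k} {f : MvPolynomial (Fin n) k}
    (h : (f.totalDegree : ℕ∞) < σ.order) : contract σ f = 0 := by
  rw [contract_eq_zero_iff]
  intro τ
  rw [constantCoeff_contract]
  refine Finset.sum_eq_zero fun γ hγ => ?_
  rw [MvPowerSeries.coeff_of_lt_order, zero_mul, mul_zero]
  have h1 : degree γ ≤ f.totalDegree := MvPolynomial.le_totalDegree hγ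
  calc ((degree γ : ℕ) : ℕ∞) ≤ f.totalDegree := by exact_mod_cast h1
    _ < σ.order := h
    _ ≤ τ.order + σ.order := le_add_self
    _ ≤ (τ * σ).order := MvPowerSeries.le_order_mul

theorem mem_maximalIdeal_iff (σ : MvPowerSeries (Fin n) k) :
    σ ∈ IsLocalRing.maximalIdeal (MvPowerSeries (Fin n) k) ↔
      MvPowerSeries.constantCoeff σ = 0 := by
  rw [IsLocalRing.mem_maximalIdeal, mem_nonunits_iff, MvPowerSeries.isUnit_iff_constantCoeff,
    isUnit_iff_ne_zero, not_not]

theorem le_order_of_mem_maximalIdeal_pow {σ : MvPowerSeries (Fin n) k} {d : ℕ}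
    (h : σ ∈ IsLocalRing.maximalIdeal (MvPowerSeries (Fin n) k) ^ d) : (d : ℕ∞) ≤ σ.order := by
  induction d generalizing σ with
  | zero => simp
  | succ d ih =>
    rw [pow_succ] at h
    refine Submodule.mul_induction_on h (fun a ha b hb => ?_) fun a b ha hb => ?_
    · refine le_trans ?_ MvPowerSeries.le_order_mul
      push_cast
      exact add_le_add (ih ha) (MvPowerSeries.one_le_order_iff_constCoeff_eq_zero.mpr
        ((mem_maximalIdeal_iff b).mp hb))
    · exact le_trans (le_min ha hb) MvPowerSeries.min_order_le_add

theorem lt_order_sub_truncTotal (σ : MvPowerSeries (Fin n) k) (d : ℕ) :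
    (d : ℕ∞) < (σ - (MvPowerSeries.truncTotal (d + 1) σ : MvPolynomial (Fin n) k)).order := by
  refine lt_of_lt_of_le (b := ((d + 1 : ℕ) : ℕ∞)) (by exact_mod_cast Nat.lt_succ_self d) ?_
  refine MvPowerSeries.nat_le_order fun γ hγ => ?_
  rw [map_sub, MvPolynomial.coeff_coe, MvPowerSeries.coeff_truncTotal _ hγ, sub_self]

theorem apolarMax_pow_succ_totalDegree [CharZero k] (f : MvPolynomial (Fin n) k) :
    apolarMax f ^ (f.totalDegree + 1) = ⊥ := by
  rw [apolarMax, ← Ideal.map_pow, Ideal.map_eq_bot_iff_le_ker, Ideal.mk_ker]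
  intro σ hσ
  refine contract_eq_zero_of_lt_order ?_
  exact lt_of_lt_of_le (by exact_mod_cast Nat.lt_succ_self _) (le_order_of_mem_maximalIdeal_pow hσ)

theorem monomial_mem_maximalIdeal_pow (γ : Fin n →₀ ℕ) :
    MvPowerSeries.monomial γ (1 : k) ∈
      IsLocalRing.maximalIdeal (MvPowerSeries (Fin n) k) ^ degree γ := by
  rw [MvPowerSeries.monomial_one_eq, Finsupp.prod_fintype _ _ (by simp), degree_eq_sum,
    ← Finset.prod_pow_eq_pow_sum]
  refine Ideal.prod_mem_prod fun i _ => Ideal.pow_mem_pow ?_ _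
  rw [mem_maximalIdeal_iff, MvPowerSeries.constantCoeff_X]

/-- A monomial of top degree in the support of `f` gives an operator in the required power of the
maximal ideal, and it pairs with `f` to a nonzero constant. -/
theorem apolarMax_pow_totalDegree_ne_bot [CharZero k] {f : MvPolynomial (Fin n) k} (hf : f ≠ 0) :
    apolarMax f ^ f.totalDegree ≠ ⊥ := by
  obtain ⟨γ, hγ, hd⟩ : ∃ γ ∈ f.support, f.totalDegree = degree γ := by
    obtain ⟨γ, hγ, h⟩ := Finset.exists_mem_eq_sup f.support
      (MvPolynomial.support_nonempty.mpr hf) (fun s => s.sum fun _ e => e)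
    exact ⟨γ, hγ, h⟩
  rw [apolarMax, ← Ideal.map_pow, Ne, Ideal.map_eq_bot_iff_le_ker, Ideal.mk_ker]
  intro h
  have h1 : contract (MvPowerSeries.monomial γ (1 : k)) f = 0 :=
    h (hd ▸ monomial_mem_maximalIdeal_pow γ)
  have h2 := constantCoeff_contract_monomial γ f
  rw [h1, map_zero] at h2
  exact mul_ne_zero (MvPolynomial.mem_support_iff.mp hγ) (prod_factorial_ne_zero γ) h2.symm

/-- The dual generator of the apolar algebra of `f`: it maps the class of `σ` to the constant
term of `σ ⌟ f`. -/
noncomputable def apolarFunctional (f : MvPolynomial (Fin n) k) : ApolarAlgebra f →ₗ[k] k :=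
  (((perp f).restrictScalars k).liftQ
    { toFun := fun σ => MvPolynomial.constantCoeff (contract σ f)
      map_add' := fun σ τ => by rw [contract_add, LinearMap.add_apply, map_add]
      map_smul' := fun c σ => by
        rw [constantCoeff_contract, constantCoeff_contract, RingHom.id_apply, Finset.smul_sum]
        refine Finset.sum_congr rfl fun γ _ => ?_
        rw [MvPowerSeries.coeff_smul, smul_eq_mul]
        ring }
    (fun σ hσ => by
      have h : contract σ f = 0 := hσ
      simp [h])) ∘ₗ
    (Submodule.Quotient.restrictScalarsEquiv k (perp f)).symm.toLinearMap

theorem apolarFunctional_mk (f : MvPolynomial (Fin n) k) (σ : MvPowerSeries (Fin n) k) :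
    apolarFunctional f (Ideal.Quotient.mk (perp f) σ) =
      MvPolynomial.constantCoeff (contract σ f) := rfl

theorem apolarFunctional_nondegenerate [CharZero k] (f : MvPolynomial (Fin n) k) (x : ApolarAlgebra f)
    (h : ∀ a, apolarFunctional f (a * x) = 0) : x = 0 := by
  obtain ⟨σ, rfl⟩ := Ideal.Quotient.mk_surjective x
  refine Ideal.Quotient.eq_zero_iff_mem.mpr ((contract_eq_zero_iff σ f).mpr fun τ => ?_)
  rw [← apolarFunctional_mk, map_mul]
  exact h _

theorem mk_eq_mk_truncTotal [CharZero k] (f : MvPolynomial (Fin n) k) (σ : MvPowerSeries (Fin n) k) :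
    Ideal.Quotient.mk (perp f) σ = Ideal.Quotient.mk (perp f)
      ((MvPowerSeries.truncTotal (f.totalDegree + 1) σ : MvPolynomial (Fin n) k) :
        MvPowerSeries (Fin n) k) := by
  rw [Ideal.Quotient.eq]
  exact contract_eq_zero_of_lt_order (lt_order_sub_truncTotal σ _)

instance finiteDimensional_apolarAlgebra [CharZero k] (f : MvPolynomial (Fin n) k) :
    FiniteDimensional k (ApolarAlgebra f) := by
  let s := (finite_of_degree_lt (σ := Fin n) (f.totalDegree + 1)).toFinset
  let L : (s → k) →ₗ[k] ApolarAlgebra f :=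
    Fintype.linearCombination k fun γ => Ideal.Quotient.mk (perp f) (MvPowerSeries.monomial γ.1 1)
  refine Module.Finite.of_surjective L fun x => ?_
  obtain ⟨σ, rfl⟩ := Ideal.Quotient.mk_surjective x
  refine ⟨fun γ => MvPowerSeries.coeff γ.1 σ, ?_⟩
  rw [Fintype.linearCombination_apply, mk_eq_mk_truncTotal]
  have h : ((MvPowerSeries.truncTotal (f.totalDegree + 1) σ : MvPolynomial (Fin n) k) :
        MvPowerSeries (Fin n) k) =
      ∑ γ : s, MvPowerSeries.coeff γ.1 σ • MvPowerSeries.monomial γ.1 1 := by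
    rw [Finset.sum_coe_sort s fun γ => MvPowerSeries.coeff γ σ • MvPowerSeries.monomial γ 1]
    ext β
    rw [MvPolynomial.coeff_coe, map_sum, MvPowerSeries.coeff_truncTotal_eq_ite]
    simp [MvPowerSeries.coeff_monomial, s]
  rw [h, map_sum]
  rfl

theorem apolarMax_eq_span [CharZero k] (f : MvPolynomial (Fin n) k) :
    apolarMax f = Ideal.span
      (Set.range fun i => Ideal.Quotient.mk (perp f) (MvPowerSeries.X i)) := by
  refine le_antisymm (Ideal.map_le_iff_le_comap.mpr fun σ hσ => ?_)
    (Ideal.span_le.mpr ?_)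
  · rw [Ideal.mem_comap, mk_eq_mk_truncTotal]
    have h1 : MvPowerSeries.truncTotal (f.totalDegree + 1) σ ∈ MvPolynomial.idealOfVars (Fin n) k := by
      rw [← pow_one (MvPolynomial.idealOfVars (Fin n) k), MvPolynomial.mem_pow_idealOfVars_iff']
      intro γ hγ
      obtain rfl : γ = 0 := by rwa [Nat.lt_one_iff, degree_eq_zero_iff] at hγ
      rw [MvPowerSeries.coeff_truncTotal _ (by simp)]
      simpa using (mem_maximalIdeal_iff σ).mp hσ
    have h2 := Ideal.mem_map_of_mem
      ((Ideal.Quotient.mk (perp f)).comp (MvPolynomial.coeToMvPowerSeries.ringHom)) h1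
    rw [Ideal.map_span, ← Set.range_comp] at h2
    simpa [Function.comp_def] using h2
  · rintro _ ⟨i, rfl⟩
    refine Ideal.mem_map_of_mem _ ?_
    rw [mem_maximalIdeal_iff, MvPowerSeries.constantCoeff_X]

theorem exists_sub_algebraMap_mem_apolarMax (f : MvPolynomial (Fin n) k) (x : ApolarAlgebra f) :
    ∃ c : k, x - algebraMap k _ c ∈ apolarMax f := by
  obtain ⟨σ, rfl⟩ := Ideal.Quotient.mk_surjective x
  refine ⟨MvPowerSeries.constantCoeff σ, ?_⟩
  have : σ - MvPowerSeries.C (MvPowerSeries.constantCoeff σ) ∈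
      IsLocalRing.maximalIdeal (MvPowerSeries (Fin n) k) := by
    rw [mem_maximalIdeal_iff]
    simp
  have h := Ideal.mem_map_of_mem (Ideal.Quotient.mk (perp f)) this
  rw [map_sub] at h
  exact h

end Pairing

/-! ### Inverse systems and Macaulay's correspondence. -/

section DualPolynomial

open Finsupp

variable {k : Type*} [Field k] {n : ℕ} {A : Type*} [CommRing A] [Algebra k A]

/-- The inverse system `∑_{|γ| ≤ j} φ(z^γ) x^γ / γ!` of a functional `φ` on an algebra with
respect to elements `z₁, …, zₙ`. -/
noncomputable def dualPolynomial (j : ℕ) (φ : A →ₗ[k] k) (z : Fin n → A) :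
    MvPolynomial (Fin n) k :=
  ∑ γ ∈ (finite_of_degree_lt (σ := Fin n) (j + 1)).toFinset,
    MvPolynomial.monomial γ (φ (∏ i, z i ^ γ i) * ((∏ i, (γ i).factorial : ℕ) : k)⁻¹)

theorem coeff_dualPolynomial (j : ℕ) (φ : A →ₗ[k] k) (z : Fin n → A) (γ : Fin n →₀ ℕ) :
    (dualPolynomial j φ z).coeff γ =
      if degree γ < j + 1 then φ (∏ i, z i ^ γ i) * ((∏ i, (γ i).factorial : ℕ) : k)⁻¹ else 0 := by
  classical
  rw [dualPolynomial, MvPolynomial.coeff_sum]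
  simp [MvPolynomial.coeff_monomial]

/-- The factor `1/γ!` in the inverse system cancels the `γ!` of the pairing. Truncation at degree
`j` loses nothing because `ψ` kills series of order greater than `j`. -/
theorem constantCoeff_contract_dualPolynomial [CharZero k] {j : ℕ} (φ : A →ₗ[k] k)
    {z : Fin n → A} (ψ : MvPowerSeries (Fin n) k →ₐ[k] A) (hX : ∀ i, ψ (MvPowerSeries.X i) = z i)
    (hψ : ∀ σ : MvPowerSeries (Fin n) k, (j : ℕ∞) < σ.order → ψ σ = 0)
    (σ : MvPowerSeries (Fin n) k) :
    MvPolynomial.constantCoeff (contract σ (dualPolynomial j φ z)) = φ (ψ σ) := by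
  set s := (finite_of_degree_lt (σ := Fin n) (j + 1)).toFinset with hs
  have hsub : (dualPolynomial j φ z).support ⊆ s := by
    intro γ hγ
    rw [MvPolynomial.mem_support_iff, coeff_dualPolynomial] at hγ
    by_contra h
    exact hγ (if_neg (by simpa [hs] using h))
  have h1 : ψ σ = ψ ((MvPowerSeries.truncTotal (j + 1) σ : MvPolynomial (Fin n) k) :
      MvPowerSeries (Fin n) k) := by
    rw [← sub_eq_zero, ← map_sub]
    exact hψ _ (lt_order_sub_truncTotal σ j)
  have h2 : ((MvPowerSeries.truncTotal (j + 1) σ : MvPolynomial (Fin n) k) :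
        MvPowerSeries (Fin n) k) =
      ∑ γ ∈ s, MvPowerSeries.coeff γ σ • MvPowerSeries.monomial γ 1 := by
    ext β
    rw [MvPolynomial.coeff_coe, map_sum, MvPowerSeries.coeff_truncTotal_eq_ite]
    simp [MvPowerSeries.coeff_monomial, s]
  rw [constantCoeff_contract_of_support_subset _ _ hsub, h1, h2, map_sum, map_sum]
  refine Finset.sum_congr rfl fun γ hγ => ?_
  rw [map_smul, map_smul, coeff_dualPolynomial, if_pos (by simpa [hs] using hγ),
    MvPowerSeries.monomial_one_eq, Finsupp.prod_fintype _ _ (by simp), map_prod ψ]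
  simp only [map_pow, hX, smul_eq_mul]
  have := prod_factorial_ne_zero (k := k) γ
  field_simp

/-- Macaulay's correspondence: an algebra generated by `z₁, …, zₙ` with a functional whose kernel
contains no nonzero ideal is the apolar algebra of its inverse system. -/
theorem nonempty_algEquiv_dualPolynomial [CharZero k] {j : ℕ} {φ : A →ₗ[k] k}
    (hφ : ∀ x, (∀ a, φ (a * x) = 0) → x = 0)
    {z : Fin n → A} (ψ : MvPowerSeries (Fin n) k →ₐ[k] A) (hX : ∀ i, ψ (MvPowerSeries.X i) = z i)
    (hψ : ∀ σ : MvPowerSeries (Fin n) k, (j : ℕ∞) < σ.order → ψ σ = 0)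
    (hsurj : Function.Surjective ψ) :
    Nonempty (A ≃ₐ[k] ApolarAlgebra (dualPolynomial j φ z)) := by
  have hker : RingHom.ker ψ = perp (dualPolynomial j φ z) := by
    ext σ
    rw [RingHom.mem_ker]
    refine Iff.trans ?_ (contract_eq_zero_iff σ _).symm
    simp only [constantCoeff_contract_dualPolynomial φ ψ hX hψ, map_mul]
    refine ⟨fun h τ => by rw [h, mul_zero, map_zero], fun h => hφ _ fun a => ?_⟩
    obtain ⟨τ, rfl⟩ := hsurj a
    exact h τ
  exact ⟨(Ideal.quotientKerAlgEquivOfSurjective hsurj).symm.trans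
    (Ideal.quotientEquivAlgOfEq k hker)⟩

/-- Elements of the maximal ideal of an apolar algebra can be substituted into power series. -/
theorem exists_algHom_apolarAlgebra [CharZero k] (f : MvPolynomial (Fin n) k)
    {z : Fin n → ApolarAlgebra f} (hz : ∀ i, z i ∈ apolarMax f) :
    ∃ ψ : MvPowerSeries (Fin n) k →ₐ[k] ApolarAlgebra f, (∀ i, ψ (MvPowerSeries.X i) = z i) ∧
      ∀ σ : MvPowerSeries (Fin n) k, (f.totalDegree : ℕ∞) < σ.order → ψ σ = 0 := by
  have hlift : ∀ i, ∃ a : MvPowerSeries (Fin n) k, MvPowerSeries.constantCoeff a = 0 ∧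
      Ideal.Quotient.mk (perp f) a = z i := by
    intro i
    obtain ⟨a, ha, hai⟩ := (Ideal.mem_map_iff_of_surjective _ Ideal.Quotient.mk_surjective).mp
      (hz i)
    exact ⟨a, (mem_maximalIdeal_iff a).mp ha, hai⟩
  choose a ha0 ha using hlift
  have hs := MvPowerSeries.hasSubst_of_constantCoeff_zero ha0
  refine ⟨(Ideal.Quotient.mkₐ k (perp f)).comp (MvPowerSeries.substAlgHom hs), fun i => ?_,
    fun σ hσ => ?_⟩
  · rw [AlgHom.comp_apply, MvPowerSeries.substAlgHom_X, ← ha i]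
    rfl
  · rw [AlgHom.comp_apply, Ideal.Quotient.mkₐ_eq_mk, Ideal.Quotient.eq_zero_iff_mem]
    -- Every substituted series has order at least `1`, so substitution does not lower the order.
    refine contract_eq_zero_of_lt_order (lt_of_lt_of_le hσ ?_)
    rw [MvPowerSeries.substAlgHom_apply]
    refine le_trans ?_ (MvPowerSeries.le_order_subst hs σ)
    calc σ.order = 1 * σ.order := (one_mul _).symm
      _ ≤ (⨅ i, (a i).order) * σ.order := by
        gcongr
        exact le_iInf fun i => MvPowerSeries.one_le_order_iff_constCoeff_eq_zero.mpr (ha0 i)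

/-- Nakayama for a nilpotent ideal: products of approximations modulo `𝔪²` approximate `𝔪^t` modulo
`𝔪^(t+1)`, and the successive corrections stop at `𝔪^N = 0`. -/
theorem subalgebra_eq_top_of_generates {𝔪 : Ideal A} {N : ℕ} (hN : 𝔪 ^ N = ⊥)
    (hres : ∀ x : A, ∃ c : k, x - algebraMap k A c ∈ 𝔪) (S : Subalgebra k A)
    (hS : ∀ x ∈ 𝔪, ∃ s ∈ S, s ∈ 𝔪 ∧ x - s ∈ 𝔪 ^ 2) : S = ⊤ := by
  have key : ∀ t, ∀ x ∈ 𝔪 ^ t, ∃ s ∈ S, s ∈ 𝔪 ^ t ∧ x - s ∈ 𝔪 ^ (t + 1) := by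
    intro t
    induction t with
    | zero =>
      intro x _
      obtain ⟨c, hc⟩ := hres x
      exact ⟨algebraMap k A c, S.algebraMap_mem c, by simp, by simpa using hc⟩
    | succ t ih =>
      intro x hx
      rw [pow_succ] at hx
      refine Submodule.mul_induction_on hx (fun a ha b hb => ?_) fun a b ha hb => ?_
      · obtain ⟨s, hs, hst, hs'⟩ := ih a ha
        obtain ⟨r, hr, hrm, hr'⟩ := hS b hb
        refine ⟨s * r, S.mul_mem hs hr, by rw [pow_succ]; exact Ideal.mul_mem_mul hst hrm, ?_⟩
        have : a * b - s * r = (a - s) * b + s * (b - r) := by ring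
        rw [this]
        refine Ideal.add_mem _ ?_ ?_
        · rw [pow_succ]
          exact Ideal.mul_mem_mul hs' hb
        · have : t + 1 + 1 = t + 2 := rfl
          rw [this, pow_add]
          exact Ideal.mul_mem_mul hst hr'
      · obtain ⟨s, hs, hst, hs'⟩ := ha
        obtain ⟨r, hr, hrt, hr'⟩ := hb
        refine ⟨s + r, S.add_mem hs hr, Ideal.add_mem _ hst hrt, ?_⟩
        have : a + b - (s + r) = (a - s) + (b - r) := by ring
        rw [this]
        exact Ideal.add_mem _ hs' hr'
  have key2 : ∀ t, ∀ x : A, ∃ s ∈ S, x - s ∈ 𝔪 ^ t := by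
    intro t
    induction t with
    | zero => exact fun x => ⟨0, S.zero_mem, by simp⟩
    | succ t ih =>
      intro x
      obtain ⟨s, hs, hs'⟩ := ih x
      obtain ⟨r, hr, -, hr'⟩ := key t _ hs'
      exact ⟨s + r, S.add_mem hs hr, by rwa [← sub_sub]⟩
  refine Algebra.eq_top_iff.mpr fun x => ?_
  obtain ⟨s, hs, hs'⟩ := key2 N x
  rw [hN, Ideal.mem_bot, sub_eq_zero] at hs'
  exact hs' ▸ hs

end DualPolynomial

/-! ### Invariance of socle degree and Loewy ideals under isomorphism. -/

section Transport

variable {k : Type*} [Field k] {A B : Type*} [CommRing A] [Algebra k A] [CommRing B] [Algebra k B]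

theorem socleDegree_map (e : A ≃ₐ[k] B) (𝔪 : Ideal A) :
    socleDegree (𝔪.map e) = socleDegree 𝔪 := by
  unfold socleDegree
  congr 1
  ext l
  simp only [Set.mem_ofPred_eq, ← Ideal.map_pow]
  rw [Ne, Ideal.map_eq_bot_iff_of_injective e.injective]

theorem mem_loewyIdeal {𝔪 : Ideal A} {a b : ℕ} {x : A} :
    x ∈ loewyIdeal 𝔪 a b ↔ x ∈ 𝔪 ^ a ∧ ∀ y ∈ 𝔪 ^ b, x * y = 0 := by
  simp [loewyIdeal, Module.mem_annihilator, Subtype.ext_iff]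

theorem loewyIdeal_map (e : A ≃ₐ[k] B) (𝔪 : Ideal A) (a b : ℕ) :
    loewyIdeal (𝔪.map e) a b = (loewyIdeal 𝔪 a b).map e := by
  have hmem : ∀ (I : Ideal A) (y : B), y ∈ I.map e ↔ e.symm y ∈ I := by
    intro I y
    rw [Ideal.mem_map_iff_of_surjective _ e.surjective]
    refine ⟨?_, fun h => ⟨_, h, e.apply_symm_apply y⟩⟩
    rintro ⟨x, hx, rfl⟩
    rwa [e.symm_apply_apply]
  ext x
  rw [hmem, mem_loewyIdeal, mem_loewyIdeal, ← Ideal.map_pow, ← Ideal.map_pow, hmem]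
  refine and_congr_right fun _ => ⟨fun h y hy => ?_, fun h y hy => ?_⟩
  · apply e.injective
    rw [map_mul, e.apply_symm_apply, map_zero]
    exact h _ ((hmem _ _).mpr (by rwa [e.symm_apply_apply]))
  · apply e.symm.injective
    rw [map_mul, map_zero]
    exact h _ ((hmem _ _).mp hy)

end Transport

/-! ### The row entries `Δ_s(1)` as dimensions of graded pieces of `𝔪/𝔪²`. -/

section Ranks

variable {k : Type*} [Field k] {A B : Type*} [CommRing A] [Algebra k A] [CommRing B] [Algebra k B]

theorem finrank_ideal_map (e : A ≃ₐ[k] B) (I : Ideal A) :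
    Module.finrank k (I.map e) = Module.finrank k I := by
  have h : (I.map e).restrictScalars k =
      (I.restrictScalars k).map (e.toLinearEquiv : A →ₗ[k] B) := by
    ext y
    simp only [Submodule.restrictScalars_mem, Submodule.mem_map]
    exact Ideal.mem_map_iff_of_surjective _ e.surjective
  exact (LinearEquiv.finrank_eq (LinearEquiv.ofEq _ _ h)).trans
    (LinearEquiv.finrank_map_eq e.toLinearEquiv (I.restrictScalars k))

variable [FiniteDimensional k A]

theorem finrank_quotient_submoduleOf {I J : Ideal A} (h : J ≤ I) :
    Module.finrank k (↥I ⧸ J.submoduleOf I) + Module.finrank k J = Module.finrank k I := by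
  have : FiniteDimensional k I :=
    inferInstanceAs (FiniteDimensional k (I.restrictScalars k))
  rw [← Submodule.finrank_quotient_add_finrank ((J.submoduleOf I).restrictScalars k),
    (Submodule.Quotient.restrictScalarsEquiv k (J.submoduleOf I)).finrank_eq]
  congr 1
  exact (((Submodule.submoduleOfEquivOfLe h).restrictScalars k).finrank_eq).symm

theorem finrank_sup_add_finrank_inf_ideal (I J : Ideal A) :
    Module.finrank k ↥(I ⊔ J) + Module.finrank k ↥(I ⊓ J) =
      Module.finrank k I + Module.finrank k J := by
  have h := Submodule.finrank_sup_add_finrank_inf_eq (I.restrictScalars k) (J.restrictScalars k)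
  rw [← Submodule.restrictScalars_sup, ← Submodule.restrictScalars_inf] at h
  exact h

theorem loewyIdeal_antitone_left (𝔪 : Ideal A) (b : ℕ) {a a' : ℕ} (h : a ≤ a') :
    loewyIdeal 𝔪 a' b ≤ loewyIdeal 𝔪 a b :=
  inf_le_inf_right _ (Ideal.pow_le_pow_right h)

theorem loewyIdeal_mono_right (𝔪 : Ideal A) (a : ℕ) {b b' : ℕ} (h : b ≤ b') :
    loewyIdeal 𝔪 a b ≤ loewyIdeal 𝔪 a b' := by
  intro x hx
  rw [mem_loewyIdeal] at hx ⊢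
  exact ⟨hx.1, fun y hy => hx.2 y (Ideal.pow_le_pow_right h hy)⟩

theorem rankQ_add_finrank (𝔪 : Ideal A) (a b : ℕ) :
    rankQ k 𝔪 a b + Module.finrank k ↥(loewyIdeal 𝔪 (a + 1) b ⊔ loewyIdeal 𝔪 a (b - 1)) =
      Module.finrank k (loewyIdeal 𝔪 a b) :=
  finrank_quotient_submoduleOf (sup_le (loewyIdeal_antitone_left 𝔪 b (Nat.le_succ a))
    (loewyIdeal_mono_right 𝔪 a (Nat.sub_le b 1)))

theorem rankQ_map (e : A ≃ₐ[k] B) (𝔪 : Ideal A) (a b : ℕ) :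
    rankQ k (𝔪.map e) a b = rankQ k 𝔪 a b := by
  have : FiniteDimensional k B := Module.Finite.equiv e.toLinearEquiv
  have h1 := rankQ_add_finrank (k := k) (𝔪.map e) a b
  rw [loewyIdeal_map, loewyIdeal_map, loewyIdeal_map, ← Ideal.map_sup, finrank_ideal_map,
    finrank_ideal_map, ← rankQ_add_finrank] at h1
  exact Nat.add_right_cancel h1

theorem hilbertDecomp_map (e : A ≃ₐ[k] B) (𝔪 : Ideal A) (s t : ℕ) :
    hilbertDecomp k (𝔪.map e) s t = hilbertDecomp k 𝔪 s t := by
  simp only [hilbertDecomp, socleDegree_map, rankQ_map]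

theorem embCount_map (e : A ≃ₐ[k] B) (𝔪 : Ideal A) (i : ℕ) :
    embCount k (𝔪.map e) i = embCount k 𝔪 i := by
  simp only [embCount, hilbertDecomp_map]

/-- By the modular law, `A_{1,b} ∩ (A_{1,b-1} + 𝔪²) = A_{2,b} + A_{1,b-1}`. So `Q_{1,b}` is the
quotient of consecutive images of the Loewy ideals in `𝔪/𝔪²`. -/
theorem rankQ_one_add (𝔪 : Ideal A) (b : ℕ) :
    rankQ k 𝔪 1 b + Module.finrank k ↥(loewyIdeal 𝔪 1 (b - 1) ⊔ 𝔪 ^ 2) =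
      Module.finrank k ↥(loewyIdeal 𝔪 1 b ⊔ 𝔪 ^ 2) := by
  have hle : loewyIdeal 𝔪 1 (b - 1) ≤ loewyIdeal 𝔪 1 b :=
    loewyIdeal_mono_right 𝔪 1 (Nat.sub_le b 1)
  have h := finrank_sup_add_finrank_inf_ideal (k := k) (loewyIdeal 𝔪 1 b)
    (loewyIdeal 𝔪 1 (b - 1) ⊔ 𝔪 ^ 2)
  have h1 : loewyIdeal 𝔪 1 b ⊔ (loewyIdeal 𝔪 1 (b - 1) ⊔ 𝔪 ^ 2) = loewyIdeal 𝔪 1 b ⊔ 𝔪 ^ 2 := by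
    rw [← sup_assoc, sup_eq_left.mpr hle]
  have h2 : loewyIdeal 𝔪 1 b ⊓ (loewyIdeal 𝔪 1 (b - 1) ⊔ 𝔪 ^ 2) =
      loewyIdeal 𝔪 (1 + 1) b ⊔ loewyIdeal 𝔪 1 (b - 1) := by
    rw [inf_comm, sup_inf_assoc_of_le _ hle, sup_comm]
    congr 1
    rw [loewyIdeal, loewyIdeal, ← inf_assoc, inf_eq_left.mpr (Ideal.pow_le_pow_right one_le_two)]
    rfl
  rw [h1, h2] at h
  have h3 := rankQ_add_finrank (k := k) 𝔪 1 b
  lia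

/-- The sum defining `embCount` telescopes along the filtration of `𝔪/𝔪²`, since `Δ_t(1)` is the
rank of `Q_{1, j-t}`. -/
theorem embCount_add_finrank (𝔪 : Ideal A) {i : ℕ} (hi : i + 1 ≤ socleDegree 𝔪) :
    embCount k 𝔪 i + Module.finrank k ↥(loewyIdeal 𝔪 1 (socleDegree 𝔪 - (i + 1)) ⊔ 𝔪 ^ 2) =
      Module.finrank k ↥(loewyIdeal 𝔪 1 (socleDegree 𝔪) ⊔ 𝔪 ^ 2) := by
  have hΔ : ∀ t, t + 1 ≤ socleDegree 𝔪 →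
      hilbertDecomp k 𝔪 t 1 = rankQ k 𝔪 1 (socleDegree 𝔪 - t) := by
    intro t ht
    rw [hilbertDecomp, if_pos ht]
    congr 1
    omega
  induction i with
  | zero =>
    rw [embCount, Finset.sum_range_one, hΔ 0 hi]
    exact rankQ_one_add 𝔪 _
  | succ i ih =>
    rw [embCount, Finset.sum_range_succ, hΔ _ hi, ← ih (by omega), embCount, add_assoc,
      ← rankQ_one_add 𝔪 (socleDegree 𝔪 - (i + 1))]
    rfl

theorem socleDegree_eq {𝔪 : Ideal A} {j : ℕ} (h : 𝔪 ^ (j + 1) = ⊥) (h' : 𝔪 ^ j ≠ ⊥) :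
    socleDegree 𝔪 = j := by
  have : {l : ℕ | 𝔪 ^ l ≠ ⊥} = Set.Iic j := by
    ext l
    simp only [Set.mem_ofPred_eq, Set.mem_Iic]
    refine ⟨fun hl => ?_, fun hl h0 => h' (le_bot_iff.mp (h0 ▸ Ideal.pow_le_pow_right hl))⟩
    by_contra hlt
    exact hl (le_bot_iff.mp (h ▸ Ideal.pow_le_pow_right (by omega)))
  rw [socleDegree, this, csSup_Iic]

theorem loewyIdeal_one_eq {𝔪 : Ideal A} {j : ℕ} (h : 𝔪 ^ (j + 1) = ⊥) :
    loewyIdeal 𝔪 1 j = 𝔪 := by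
  refine le_antisymm (inf_le_left.trans (pow_one 𝔪).le) fun x hx => ?_
  rw [mem_loewyIdeal, pow_one]
  refine ⟨hx, fun y hy => ?_⟩
  have : y * x ∈ 𝔪 ^ (j + 1) := by
    rw [pow_succ]
    exact Ideal.mul_mem_mul hy hx
  rwa [h, Ideal.mem_bot, mul_comm] at this

end Ranks

/-! ### Greedy independent vectors and orthonormal bases. -/

section LinearAlgebra

open Module

variable {k V : Type*} [Field k] [AddCommGroup V] [Module k V] [FiniteDimensional k V]

/-- Greedy choice of vectors which are independent modulo `M`. -/
theorem exists_independent_modulo (M : Submodule k V) (G : ℕ → Submodule k V) (N : ℕ)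
    (hG : ∀ r < N, r + finrank k M < finrank k ↥(G r ⊔ M)) :
    ∃ u : ℕ → V, (∀ r < N, u r ∈ G r ∧ u r ∉ M) ∧
      Disjoint (Submodule.span k (u '' Set.Iio N)) M ∧
      finrank k ↥(Submodule.span k (u '' Set.Iio N) ⊔ M) = N + finrank k M := by
  induction N with
  | zero =>
    have h0 : Set.Iio 0 = (∅ : Set ℕ) := by simp
    exact ⟨0, by simp, by simp, by rw [h0, Set.image_empty, Submodule.span_empty, bot_sup_eq, zero_add]⟩
  | succ N ih =>
    obtain ⟨u, hu, hdisj, hrank⟩ := ih fun r hr => hG r (by omega)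
    set S := Submodule.span k (u '' Set.Iio N) with hS
    -- The dimension of `S ⊔ M` is `N + finrank k M`, too small for it to contain `G N`.
    obtain ⟨x, hxG, hx⟩ : ∃ x ∈ G N, x ∉ S ⊔ M := by
      by_contra! h
      have := Submodule.finrank_mono (sup_le h le_sup_right : G N ⊔ M ≤ S ⊔ M)
      have := hG N (Nat.lt_succ_self N)
      omega
    have himage : Function.update u N x '' Set.Iio (N + 1) = insert x (u '' Set.Iio N) := by
      have : Set.Iio (N + 1) = insert N (Set.Iio N) := by
        ext r
        simp only [Set.mem_Iio, Set.mem_insert_iff]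
        omega
      rw [this, Set.image_insert_eq, Function.update_self]
      congr 1
      refine Set.image_congr fun r hr => ?_
      rw [Function.update_of_ne (ne_of_lt hr)]
    have hd : Disjoint (Submodule.span k {x}) (S ⊔ M) := by
      rw [disjoint_comm]
      refine (Submodule.disjoint_span_singleton' ?_).mpr hx
      rintro rfl
      exact hx (zero_mem _)
    refine ⟨Function.update u N x, fun r hr => ?_, ?_, ?_⟩
    · rcases Nat.lt_succ_iff_lt_or_eq.mp hr with h | rfl
      · rw [Function.update_of_ne (ne_of_lt h)]
        exact hu r h
      · rw [Function.update_self]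
        exact ⟨hxG, fun h => hx (Submodule.mem_sup_right h)⟩
    · rw [himage, Submodule.span_insert]
      exact hdisj.disjoint_sup_left_of_disjoint_sup_right hd
    · rw [himage, Submodule.span_insert, ← hS, sup_assoc]
      have h1 := Submodule.finrank_sup_add_finrank_inf_eq (Submodule.span k {x}) (S ⊔ M)
      rw [hd.eq_bot, finrank_bot, hrank, finrank_span_singleton] at h1
      · omega
      · rintro rfl
        exact hx (zero_mem _)

/-- A symmetric bilinear form over an algebraically closed field that is nondegenerate on a
subspace has an orthonormal basis there, with any prescribed common norm. -/
theorem exists_orthonormal_span [IsAlgClosed k] (h2 : (2 : k) ≠ 0) {B : LinearMap.BilinForm k V}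
    (hB : B.IsSymm) {C : Submodule k V} (hC : Disjoint C (B.orthogonal C)) {q : ℕ} (hq : finrank k C = q)
    (c : k) : ∃ o : Fin q → V, (∀ i, o i ∈ C) ∧ (c ≠ 0 → C ≤ Submodule.span k (Set.range o)) ∧
      ∀ i i', B (o i) (o i') = if i = i' then c else 0 := by
  subst hq
  let _ : Invertible (2 : k) := invertibleOfNonzero h2
  have hBC : LinearMap.IsSymm (B.restrict C) := ⟨fun x y => hB.eq x y⟩
  obtain ⟨v, hv⟩ := LinearMap.BilinForm.exists_orthogonal_basis (B := B.restrict C) hBC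
  have hv' : ∀ i i', i ≠ i' → B (v i) (v i') = 0 := fun i i' h => hv h
  -- An isotropic vector of an orthogonal basis would be orthogonal to all of `C`, hence zero.
  have hvi : ∀ i, B (v i) (v i) ≠ 0 := by
    intro i hi
    have : (v i : V) ∈ B.orthogonal C := by
      intro y hy
      have hy' : (⟨y, hy⟩ : C) ∈ Submodule.span k (Set.range v) := by
        rw [v.span_eq]
        trivial
      change B y (v i) = 0
      have key : ∀ w ∈ Submodule.span k (Set.range v), B (w : V) (v i) = 0 := by
        intro w hw
        induction hw using Submodule.span_induction with
        | mem w hw =>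
          obtain ⟨i', rfl⟩ := hw
          by_cases h : i' = i
          · rw [h, hi]
          · exact hv' _ _ h
        | zero => simp
        | add a b _ _ ha hb => simp [ha, hb]
        | smul t a _ ha => simp [ha]
      exact key _ hy'
    have h0 : (v i : V) = 0 := by
      have := hC.le_bot ⟨(v i).2, this⟩
      simpa using this
    exact v.ne_zero i (Subtype.ext h0)
  -- Rescaling by a square root of `c / B (v i) (v i)` gives the norm `c`; this is where algebraic
  -- closedness enters.
  choose s hs using fun i => IsAlgClosed.exists_eq_mul_self (c / B (v i) (v i))
  refine ⟨fun i => s i • (v i : V), fun i => C.smul_mem _ (v i).2, fun hc y hy => ?_,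
    fun i i' => ?_⟩
  · have hs0 : ∀ i, s i ≠ 0 := by
      intro i h
      have := hs i
      rw [h, mul_zero, div_eq_zero_iff] at this
      exact this.elim hc (hvi i)
    have h1 : (⟨y, hy⟩ : C) = ∑ i, v.repr ⟨y, hy⟩ i • v i := (v.sum_repr _).symm
    have h2 : y = ∑ i, v.repr ⟨y, hy⟩ i • (v i : V) := by
      have := congrArg C.subtype h1
      rw [map_sum] at this
      simpa only [map_smul, Submodule.subtype_apply] using this
    rw [h2]
    refine Submodule.sum_mem _ fun i _ => Submodule.smul_mem _ _ ?_
    have : (v i : V) = (s i)⁻¹ • (s i • (v i : V)) := by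
      rw [smul_smul, inv_mul_cancel₀ (hs0 i), one_smul]
    rw [this]
    exact Submodule.smul_mem _ _ (Submodule.subset_span ⟨i, rfl⟩)
  · by_cases h : i = i'
    · subst h
      have h3 := hs i
      have h4 := hvi i
      rw [if_pos rfl]
      simp only [map_smul, LinearMap.smul_apply, smul_eq_mul]
      rw [← mul_assoc, ← h3, div_mul_cancel₀ _ h4]
    · simp [h, hv' _ _ h]

end LinearAlgebra

/-! ### Gorenstein duality: annihilators and change of functional. -/

section Duality

open Module

variable {k : Type*} [Field k] {A : Type*} [CommRing A] [Algebra k A]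

/-- The bilinear form `(x, y) ↦ φ(xy)`. -/
noncomputable def mulForm (φ : A →ₗ[k] k) : LinearMap.BilinForm k A :=
  (LinearMap.mul k A).compr₂ φ

@[simp]
theorem mulForm_apply (φ : A →ₗ[k] k) (x y : A) : mulForm φ x y = φ (x * y) := rfl

theorem mulForm_isSymm (φ : A →ₗ[k] k) : (mulForm φ).IsSymm :=
  ⟨fun x y => by simp [mul_comm]⟩

variable {φ : A →ₗ[k] k} {𝔪 : Ideal A}

theorem mulForm_nondegenerate (hφ : ∀ x, (∀ a, φ (a * x) = 0) → x = 0) :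
    (mulForm φ).Nondegenerate := by
  refine ⟨fun x hx => hφ x fun a => ?_, fun x hx => hφ x fun a => hx a⟩
  rw [mul_comm]
  exact hx a

variable [FiniteDimensional k A]

/-- The double annihilator property of ideals of a Gorenstein algebra. -/
theorem mem_of_forall_annihilator (hφ : ∀ x, (∀ a, φ (a * x) = 0) → x = 0) (I : Ideal A) {x : A}
    (hx : ∀ y, (∀ w ∈ I, w * y = 0) → φ (y * x) = 0) : x ∈ I := by
  have h := LinearMap.BilinForm.orthogonal_orthogonal (mulForm_nondegenerate hφ)
    (mulForm_isSymm φ).isRefl (I.restrictScalars k)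
  have h1 : x ∈ I.restrictScalars k := by
    rw [← h]
    intro y hy
    refine hx y fun w hw => hφ _ fun a => ?_
    rw [← mul_assoc]
    exact hy (a * w) (I.mul_mem_left a hw)
  exact h1

theorem annihilator_sq_le (hunit : ∀ x ∉ 𝔪, IsUnit x) (h2 : 𝔪 ^ 2 ≠ ⊥) {x : A}
    (hx : ∀ y ∈ 𝔪 ^ 2, y * x = 0) : x ∈ 𝔪 := by
  by_contra h
  refine h2 (le_bot_iff.mp fun y hy => ?_)
  exact (hunit x h).mul_left_eq_zero.mp (hx y hy)

/-- By the double annihilator property it suffices that `φ(yx) = 0` for all `y` killed by `𝔪²`. Such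
`y` are not units, as `𝔪² ≠ 0`, so they lie in `𝔪` and `x` kills them. -/
theorem annihilator_le_sq (hφ : ∀ x, (∀ a, φ (a * x) = 0) → x = 0)
    (hunit : ∀ x ∉ 𝔪, IsUnit x) (h2 : 𝔪 ^ 2 ≠ ⊥) {x : A}
    (hx : ∀ y ∈ 𝔪, x * y = 0) : x ∈ 𝔪 ^ 2 := by
  refine mem_of_forall_annihilator hφ _ fun y hy => ?_
  rw [mul_comm, hx y (annihilator_sq_le hunit h2 hy), map_zero]

theorem loewyIdeal_one_one_le (hφ : ∀ x, (∀ a, φ (a * x) = 0) → x = 0)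
    (hunit : ∀ x ∉ 𝔪, IsUnit x) (h2 : 𝔪 ^ 2 ≠ ⊥) :
    loewyIdeal 𝔪 1 1 ≤ 𝔪 ^ 2 := by
  intro x hx
  rw [mem_loewyIdeal, pow_one] at hx
  exact annihilator_le_sq hφ hunit h2 hx.2

/-- A functional that agrees on `𝔪²` with a nondegenerate one is nondegenerate. -/
theorem nondegenerate_of_eqOn_sq (hφ : ∀ x, (∀ a, φ (a * x) = 0) → x = 0)
    (hunit : ∀ x ∉ 𝔪, IsUnit x) (h2 : 𝔪 ^ 2 ≠ ⊥) {N : ℕ} (hN : 𝔪 ^ N = ⊥) {φ' : A →ₗ[k] k}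
    (h : ∀ x ∈ 𝔪 ^ 2, φ' x = φ x) (x : A) (hx : ∀ a, φ' (a * x) = 0) : x = 0 := by
  -- Descent on the power of `𝔪`: if `𝔪^(r+1)` kills `x`, then `𝔪^r x` lies in the socle, hence in
  -- `𝔪²`, where `φ` and `φ'` agree. Thus `φ` vanishes on the ideal generated by each `y * x`.
  have key : ∀ t ≤ N, ∀ y ∈ 𝔪 ^ (N - t), y * x = 0 := by
    intro t
    induction t with
    | zero =>
      intro _ y hy
      rw [Nat.sub_zero, hN, Ideal.mem_bot] at hy
      rw [hy, zero_mul]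
    | succ t ih =>
      intro ht y hy
      have hsoc : y * x ∈ 𝔪 ^ 2 := by
        refine annihilator_le_sq hφ hunit h2 fun w hw => ?_
        have : y * w ∈ 𝔪 ^ (N - t) := by
          have h1 : N - t = N - (t + 1) + 1 := by omega
          rw [h1, pow_succ]
          exact Ideal.mul_mem_mul hy hw
        rw [mul_right_comm]
        exact ih (by omega) _ this
      refine hφ _ fun a => ?_
      rw [← h _ (Ideal.mul_mem_left _ a hsoc), ← mul_assoc]
      exact hx _
  simpa using key N le_rfl 1 (by simp)

end Duality

/-! ### Generators adapted to the Loewy filtration. -/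

section AdaptedGenerators

open Module

variable {k : Type*} [Field k] {A : Type*} [CommRing A] [Algebra k A] {n : ℕ}

/-- Generators `z₀, …, z_{n-1}` of `𝔪` adapted to the Loewy filtration: modulo `𝔪²` the last
ones span the images of the ideals `(0 : 𝔪^b)`, those with index in `[e, e + q)` are orthogonal for
the form `φ(xy)` and annihilate `𝔪²`, and those with index at least `e + q` vanish. -/
structure IsAdapted (φ : A →ₗ[k] k) (𝔪 : Ideal A) (e q : ℕ) (z : Fin n → A) : Prop where
  mem : ∀ l, z l ∈ 𝔪
  generates : ∀ x ∈ 𝔪, ∃ s ∈ Submodule.span k (Set.range z), x - s ∈ 𝔪 ^ 2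
  disjoint : Disjoint (Submodule.span k (Set.range z)) ((𝔪 ^ 2).restrictScalars k)
  mul_eq_zero : ∀ l : Fin n, e ≤ l → ∀ y ∈ 𝔪 ^ 2, z l * y = 0
  exists_mul_ne_zero : ∀ l : Fin n, (l : ℕ) < e → ∃ y ∈ 𝔪 ^ 2, z l * y ≠ 0
  orthogonal : ∀ l l' : Fin n, e ≤ l → l ≠ l' → φ (z l * z l') = 0
  norm : ∀ l : Fin n, e ≤ l → (l : ℕ) < e + q → φ (z l * z l) = 2
  eq_zero : ∀ l : Fin n, e + q ≤ l → z l = 0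
  mul_eq_zero_of_le : ∀ b, 1 ≤ b → ∀ l : Fin n,
    finrank k 𝔪 ≤ l + finrank k ↥(loewyIdeal 𝔪 1 b ⊔ 𝔪 ^ 2) → ∀ y ∈ 𝔪 ^ b, z l * y = 0

variable [FiniteDimensional k A] {φ : A →ₗ[k] k} {𝔪 : Ideal A}

/-- A complement of `𝔪² ∩ (0 : 𝔪²)` in `𝔪 ∩ (0 : 𝔪²)`; the form `φ(xy)` is nondegenerate on it. -/
theorem exists_nondegenerate_complement (hφ : ∀ x, (∀ a, φ (a * x) = 0) → x = 0)
    (hunit : ∀ x ∉ 𝔪, IsUnit x) (h2 : 𝔪 ^ 2 ≠ ⊥) :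
    ∃ C : Submodule k A, C ≤ (loewyIdeal 𝔪 1 2).restrictScalars k ∧
      Disjoint C ((𝔪 ^ 2).restrictScalars k) ∧
      (loewyIdeal 𝔪 1 2).restrictScalars k ≤ C ⊔ (𝔪 ^ 2).restrictScalars k ∧
      finrank k C = rankQ k 𝔪 1 2 ∧ Disjoint C ((mulForm φ).orthogonal C) := by
  set M := (𝔪 ^ 2).restrictScalars k with hM
  set N := (loewyIdeal 𝔪 1 2).restrictScalars k with hN
  obtain ⟨E, hE⟩ := exists_isCompl (N ⊓ M)
  have hdisj : Disjoint (E ⊓ N) M := by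
    rw [disjoint_iff, inf_assoc, inf_comm, hE.inf_eq_bot]
  have hsup : N ⊓ M ⊔ E ⊓ N = N := by
    rw [← sup_inf_assoc_of_le E (inf_le_left : N ⊓ M ≤ N), hE.sup_eq_top, top_inf_eq]
  have hle : N ≤ E ⊓ N ⊔ M := by
    conv_lhs => rw [← hsup]
    exact sup_le (inf_le_right.trans le_sup_right) le_sup_left
  refine ⟨E ⊓ N, inf_le_right, hdisj, hle, ?_, ?_⟩
  · have h1 := rankQ_one_add (k := k) 𝔪 2
    rw [Nat.add_one_sub_one, sup_eq_right.mpr (loewyIdeal_one_one_le hφ hunit h2)] at h1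
    have h3 := Submodule.finrank_sup_add_finrank_inf_eq (E ⊓ N) M
    rw [hdisj.eq_bot, finrank_bot] at h3
    have h4 : E ⊓ N ⊔ M = (loewyIdeal 𝔪 1 2 ⊔ 𝔪 ^ 2).restrictScalars k := by
      rw [Submodule.restrictScalars_sup]
      exact le_antisymm (sup_le_sup_right inf_le_right _) (sup_le hle le_sup_right)
    rw [h4] at h3
    have h5 : finrank k ↥(loewyIdeal 𝔪 1 2 ⊔ 𝔪 ^ 2) =
        finrank k ↥(E ⊓ N) + finrank k ↥(𝔪 ^ 2) := h3
    rw [h5] at h1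
    exact (Nat.add_right_cancel h1).symm
  · rw [Submodule.disjoint_def]
    intro c hc hc'
    have hcN : c ∈ loewyIdeal 𝔪 1 2 := hc.2
    -- By double annihilators, test `c` against `y ∈ (0 : 𝔪²)`, which lies in `N`. The part of `y`
    -- in `𝔪²` is killed by `c`, and the part in the complement is orthogonal to `c` by assumption.
    have hcM : c ∈ M := by
      refine mem_of_forall_annihilator hφ _ fun y hy => ?_
      have hyN : y ∈ N := by
        refine mem_loewyIdeal.mpr ⟨?_, fun w hw => by rw [mul_comm]; exact hy w hw⟩
        rw [pow_one]
        exact annihilator_sq_le hunit h2 hy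
      rw [← hsup] at hyN
      obtain ⟨y₁, hy₁, y₂, hy₂, rfl⟩ := Submodule.mem_sup.mp hyN
      have e1 : y₁ * c = 0 := by
        rw [mul_comm]
        exact (mem_loewyIdeal.mp hcN).2 _ hy₁.2
      have e2 : φ (y₂ * c) = 0 := hc' y₂ hy₂
      rw [add_mul, e1, zero_add, e2]
    exact Submodule.disjoint_def.mp hdisj c hc hcM

/-- Nondegeneracy on `C` gives `𝔪 = C ⊕ U` with `U` the orthogonal of `C` in `𝔪`, and `𝔪² ⊆ U`
because `C` kills `𝔪²`. For `b ≥ 2` the Loewy ideals contain `C` and split accordingly. The first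
`e` generators can therefore be chosen inside `U`, adapted to the filtration, without disturbing
orthogonality to the basis of `C`; zeros fill the remaining places. -/
theorem exists_isAdapted [IsAlgClosed k] [CharZero k] (hφ : ∀ x, (∀ a, φ (a * x) = 0) → x = 0)
    (hunit : ∀ x ∉ 𝔪, IsUnit x) (h2 : 𝔪 ^ 2 ≠ ⊥) {j : ℕ} (hj : 2 ≤ j) (hjm : 𝔪 ^ (j + 1) = ⊥)
    (hn : finrank k 𝔪 ≤ n + finrank k ↥(𝔪 ^ 2)) :
    ∃ (e : ℕ) (z : Fin n → A), e + rankQ k 𝔪 1 2 ≤ n ∧ IsAdapted φ 𝔪 e (rankQ k 𝔪 1 2) z := by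
  obtain ⟨C, hCN, hCM, hNC, hCq, hC⟩ := exists_nondegenerate_complement (k := k) hφ hunit h2
  set q := rankQ k 𝔪 1 2 with hq
  obtain ⟨o, hoC, hCo, ho⟩ := exists_orthonormal_span two_ne_zero (mulForm_isSymm φ) hC hCq 2
  replace hCo := hCo two_ne_zero
  set M := (𝔪 ^ 2).restrictScalars k with hM
  set V := 𝔪.restrictScalars k with hV
  set U := (mulForm φ).orthogonal C ⊓ V with hU
  have hMV : M ≤ V := fun x hx => Ideal.pow_le_self two_ne_zero hx
  have hCV : C ≤ V := fun c hc => by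
    have := (mem_loewyIdeal.mp (hCN hc)).1
    rwa [pow_one] at this
  have hMU : M ≤ U := le_inf (fun x hx c hc => by
    change φ (c * x) = 0
    rw [(mem_loewyIdeal.mp (hCN hc)).2 x hx, map_zero]) hMV
  have hCU : Disjoint C U := hC.mono_right inf_le_left
  have hsup : C ⊔ U = V := by
    rw [hU, ← sup_inf_assoc_of_le _ hCV,
      ((LinearMap.BilinForm.isCompl_orthogonal_iff_disjoint (mulForm_isSymm φ).isRefl).mpr
        hC).sup_eq_top, top_inf_eq]
  have hrankU : finrank k 𝔪 = q + finrank k U := by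
    have := Submodule.finrank_sup_add_finrank_inf_eq C U
    rw [hCU.eq_bot, finrank_bot, hsup, hCq] at this
    exact this
  let N : ℕ → Submodule k A := fun b => (loewyIdeal 𝔪 1 b).restrictScalars k
  have hCNb : ∀ b, 2 ≤ b → C ≤ N b := fun b hb => hCN.trans (loewyIdeal_mono_right 𝔪 1 hb)
  have hNV : ∀ b, N b ≤ V := fun b x hx => by
    have := (mem_loewyIdeal.mp hx).1
    rwa [pow_one] at this
  have hd : ∀ b, 2 ≤ b → finrank k ↥(loewyIdeal 𝔪 1 b ⊔ 𝔪 ^ 2) =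
      q + finrank k ↥(N b ⊓ U ⊔ M) := by
    intro b hb
    have h1 : (loewyIdeal 𝔪 1 b ⊔ 𝔪 ^ 2).restrictScalars k = C ⊔ (N b ⊓ U ⊔ M) := by
      rw [Submodule.restrictScalars_sup, ← sup_assoc, inf_comm, ← sup_inf_assoc_of_le U (hCNb b hb),
        hsup, inf_eq_right.mpr (hNV b)]
    have h3 := Submodule.finrank_sup_add_finrank_inf_eq C (N b ⊓ U ⊔ M)
    rw [(hCU.mono_right (sup_le inf_le_right hMU)).eq_bot, finrank_bot, ← h1, hCq] at h3
    exact h3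
  obtain ⟨e, he⟩ : ∃ e, finrank k U = e + finrank k M :=
    ⟨finrank k U - finrank k M, (Nat.sub_add_cancel (Submodule.finrank_mono hMU)).symm⟩
  have hdj : finrank k ↥(N j ⊓ U ⊔ M) = e + finrank k M := by
    have h1 := hd j hj
    rw [loewyIdeal_one_eq hjm, sup_eq_left.mpr (Ideal.pow_le_self two_ne_zero), hrankU] at h1
    omega
  -- `b r` is the least `b ≥ 2` for which the image of `(0 : 𝔪^b) ∩ U` modulo `𝔪²` has dimension
  -- greater than `r`, so the greedy choice takes the `r`-th vector from the smallest possible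
  -- annihilator. The value for `r ≥ e` is a dummy.
  have hb : ∀ r, ∃ b, r < e → 2 ≤ b ∧ r + finrank k M < finrank k ↥(N b ⊓ U ⊔ M) ∧
      ∀ b', 2 ≤ b' → r + finrank k M < finrank k ↥(N b' ⊓ U ⊔ M) → b ≤ b' := by
    intro r
    by_cases hr : r < e
    · classical
      have hex : ∃ b, 2 ≤ b ∧ r + finrank k M < finrank k ↥(N b ⊓ U ⊔ M) :=
        ⟨j, hj, by rw [hdj]; omega⟩
      exact ⟨Nat.find hex, fun _ => ⟨(Nat.find_spec hex).1, (Nat.find_spec hex).2,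
        fun b' h1 h2 => Nat.find_min' hex ⟨h1, h2⟩⟩⟩
    · exact ⟨0, fun h => absurd h hr⟩
  choose b hb using hb
  obtain ⟨u, hu, huM, huS⟩ := exists_independent_modulo M (fun r => N (b r) ⊓ U) e
    fun r hr => (hb r hr).2.1
  set S := Submodule.span k (u '' Set.Iio e) with hS
  have hSU : S ≤ U := by
    refine Submodule.span_le.mpr ?_
    rintro _ ⟨r, hr, rfl⟩
    exact (hu r hr).1.2
  have hSM : S ⊔ M = U := Submodule.eq_of_le_of_finrank_eq (sup_le hSU hMU) (huS.trans he.symm)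
  have heqn : e + q ≤ n := by
    have : finrank k ↥(𝔪 ^ 2) = finrank k M := rfl
    omega
  -- The greedy vectors start in the small annihilators, while the standard form wants those last;
  -- hence the reversal `e - 1 - l`.
  let z : Fin n → A := fun l =>
    if (l : ℕ) < e then u (e - 1 - l) else if h : (l : ℕ) - e < q then o ⟨l - e, h⟩ else 0
  have hz1 : ∀ l : Fin n, (l : ℕ) < e → z l = u (e - 1 - l) := fun l hl => if_pos hl
  have hz2 : ∀ l : Fin n, e ≤ l → ∀ h : (l : ℕ) - e < q, z l = o ⟨l - e, h⟩ := fun l hl h => by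
    simp only [z]
    rw [if_neg (by omega), dif_pos h]
  have hz3 : ∀ l : Fin n, e + q ≤ l → z l = 0 := fun l hl => by
    simp only [z]
    rw [if_neg (by omega), dif_neg (by omega)]
  have hzC : ∀ l : Fin n, e ≤ l → z l ∈ C := fun l hl => by
    by_cases h : (l : ℕ) - e < q
    · rw [hz2 l hl h]
      exact hoC _
    · rw [hz3 l (by omega)]
      exact zero_mem _
  have hzu : ∀ l : Fin n, (l : ℕ) < e → z l ∈ N (b (e - 1 - l)) ⊓ U ∧ z l ∉ M := fun l hl => by
    rw [hz1 l hl]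
    exact hu _ (by omega)
  have hspan : Submodule.span k (Set.range z) = C ⊔ S := by
    refine le_antisymm (Submodule.span_le.mpr ?_) (sup_le (hCo.trans (Submodule.span_le.mpr ?_))
      (Submodule.span_le.mpr ?_))
    · rintro _ ⟨l, rfl⟩
      by_cases hl : (l : ℕ) < e
      · rw [hz1 l hl]
        exact Submodule.mem_sup_right (Submodule.subset_span ⟨_, Set.mem_Iio.mpr (by omega), rfl⟩)
      · exact Submodule.mem_sup_left (hzC l (by omega))
    · rintro _ ⟨i, rfl⟩
      refine Submodule.subset_span ⟨⟨e + i, by omega⟩, ?_⟩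
      rw [hz2 _ (by simp) (by simp)]
      congr 1
      ext
      simp
    · rintro _ ⟨r, hr, rfl⟩
      rw [Set.mem_Iio] at hr
      refine Submodule.subset_span ⟨⟨e - 1 - r, by omega⟩, ?_⟩
      rw [hz1 _ (by simp only; omega)]
      congr 1
      simp only
      omega
  refine ⟨e, z, heqn, ⟨fun l => ?_, fun x hx => ?_, ?_, fun l hl y hy => ?_, fun l hl => ?_,
    fun l l' hl hne => ?_, fun l hl hl' => ?_, hz3, fun c hc l hl y hy => ?_⟩⟩
  · by_cases hl : (l : ℕ) < e
    · exact (hzu l hl).1.2.2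
    · exact hCV (hzC l (by omega))
  · have hx' : x ∈ C ⊔ S ⊔ M := by
      rw [sup_assoc, hSM, hsup]
      exact hx
    obtain ⟨s, hs, t, ht, rfl⟩ := Submodule.mem_sup.mp hx'
    exact ⟨s, hspan ▸ hs, by rw [add_sub_cancel_left]; exact ht⟩
  · rw [hspan]
    refine huM.disjoint_sup_left_of_disjoint_sup_right ?_
    rwa [hSM]
  · exact (mem_loewyIdeal.mp (hCN (hzC l hl))).2 y hy
  · by_contra! h
    obtain ⟨⟨-, hzU⟩, hzM⟩ := hzu l hl
    -- If `z l` killed `𝔪²` it would lie in `(C + 𝔪²) ∩ U`, which is `𝔪²` by the modular law,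
    -- contrary to the greedy choice.
    have h1 : z l ∈ C ⊔ M := hNC (mem_loewyIdeal.mpr ⟨by rw [pow_one]; exact hzU.2, h⟩)
    have h3 : z l ∈ (M ⊔ C) ⊓ U := ⟨by rwa [sup_comm], hzU⟩
    rw [sup_inf_assoc_of_le _ hMU, hCU.eq_bot, sup_bot_eq] at h3
    exact hzM h3
  · by_cases hl' : (l' : ℕ) < e
    · exact (hzu l' hl').1.2.1 _ (hzC l hl)
    · by_cases h : e + q ≤ l
      · rw [hz3 l h, zero_mul, map_zero]
      · by_cases h' : e + q ≤ l'
        · rw [hz3 l' h', mul_zero, map_zero]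
        · rw [hz2 l hl (by omega), hz2 l' (by omega) (by omega), ← mulForm_apply, ho, if_neg]
          intro heq
          rw [Fin.mk.injEq] at heq
          exact hne (Fin.ext (by omega))
  · rw [hz2 l hl (by omega), ← mulForm_apply, ho, if_pos rfl]
  · by_cases h : e + q ≤ l
    · rw [hz3 l h, zero_mul]
    · rcases Nat.lt_or_ge c 2 with hc2 | hc2
      · obtain rfl : c = 1 := by omega
        have h1 : finrank k ↥(loewyIdeal 𝔪 1 1 ⊔ 𝔪 ^ 2) = finrank k M := by
          rw [sup_eq_right.mpr (loewyIdeal_one_one_le hφ hunit h2)]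
          rfl
        omega
      · by_cases hle : (l : ℕ) < e
        · have h1 := hd c hc2
          obtain ⟨⟨hzN, -⟩, -⟩ := hzu l hle
          -- After cancelling the contribution `q` of `C`, the bound on `l` says that `c` is
          -- admissible in the definition of `b (e - 1 - l)`; minimality gives `b (e - 1 - l) ≤ c`.
          have hbc := (hb (e - 1 - l) (by omega)).2.2 c hc2 (by omega)
          exact (mem_loewyIdeal.mp (loewyIdeal_mono_right 𝔪 1 hbc hzN)).2 y hy
        · exact (mem_loewyIdeal.mp (hCNb c hc2 (hzC l (by omega)))).2 y hy

end AdaptedGenerators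

/-! ### Number of generators, normalised functional, surjectivity, occurring variables. -/

section Existence

open Module

variable {k : Type*} [Field k] {n : ℕ}

theorem finrank_apolarMax_le [CharZero k] (f : MvPolynomial (Fin n) k) :
    finrank k (apolarMax f) ≤ n + finrank k ↥(apolarMax f ^ 2) := by
  set x : Fin n → ApolarAlgebra f := fun i => Ideal.Quotient.mk (perp f) (MvPowerSeries.X i)
    with hx
  have hle : (apolarMax f).restrictScalars k ≤
      Submodule.span k (Set.range x) ⊔ (apolarMax f ^ 2).restrictScalars k := by
    intro y hy
    have hy' : y ∈ Submodule.span (ApolarAlgebra f) (Set.range x) := by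
      rw [Submodule.restrictScalars_mem, apolarMax_eq_span] at hy
      exact hy
    obtain ⟨c, rfl⟩ := (Submodule.mem_span_range_iff_exists_fun _).mp hy'
    refine Submodule.sum_mem _ fun i _ => ?_
    obtain ⟨t, ht⟩ := exists_sub_algebraMap_mem_apolarMax f (c i)
    have hxi : x i ∈ apolarMax f := by
      rw [apolarMax_eq_span]
      exact Ideal.subset_span ⟨i, rfl⟩
    have h1 : c i • x i = t • x i + (c i - algebraMap k _ t) * x i := by
      have h2 : t • x i = algebraMap k _ t * x i := Algebra.smul_def t (x i)
      rw [h2, smul_eq_mul]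
      ring
    rw [h1]
    refine Submodule.add_mem_sup (Submodule.smul_mem _ _ (Submodule.subset_span ⟨i, rfl⟩)) ?_
    rw [Submodule.restrictScalars_mem, pow_two]
    exact Ideal.mul_mem_mul ht hxi
  calc finrank k (apolarMax f)
      ≤ finrank k ↥(Submodule.span k (Set.range x) ⊔ (apolarMax f ^ 2).restrictScalars k) :=
        Submodule.finrank_mono hle
    _ ≤ finrank k (Submodule.span k (Set.range x)) + finrank k ↥(apolarMax f ^ 2) :=
        Submodule.finrank_add_le_finrank_add_finrank _ _
    _ ≤ n + finrank k ↥(apolarMax f ^ 2) := by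
        exact Nat.add_le_add_right ((finrank_range_le_card (R := k) x).trans (by simp)) _

/-- The line of `1`, the span of the `z l` and `𝔪²` are independent. So `φ` restricted to `𝔪²`
extends by zero along a complement containing `1` and all `z l`; this removes the terms of degree
below `2` from the inverse system. -/
theorem IsAdapted.exists_functional {A : Type*} [CommRing A] [Algebra k A] {φ : A →ₗ[k] k}
    {𝔪 : Ideal A} {e q : ℕ} {z : Fin n → A} (hz : IsAdapted φ 𝔪 e q z) (h1 : (1 : A) ∉ 𝔪) :
    ∃ φ' : A →ₗ[k] k, (∀ x ∈ 𝔪 ^ 2, φ' x = φ x) ∧ φ' 1 = 0 ∧ ∀ l, φ' (z l) = 0 := by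
  set M := (𝔪 ^ 2).restrictScalars k
  have hle : Submodule.span k (Set.range z) ⊔ M ≤ 𝔪.restrictScalars k := by
    refine sup_le (Submodule.span_le.mpr ?_) fun x hx => Ideal.pow_le_self two_ne_zero hx
    rintro _ ⟨l, rfl⟩
    exact hz.mem l
  have h1' : Disjoint (Submodule.span k {(1 : A)}) (Submodule.span k (Set.range z) ⊔ M) := by
    have h10 : (1 : A) ≠ 0 := fun h => h1 (h ▸ zero_mem 𝔪)
    rw [disjoint_comm]
    exact (Submodule.disjoint_span_singleton' h10).mpr fun h => h1 (hle h)
  obtain ⟨K, hK, hKM⟩ :=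
    (hz.disjoint.disjoint_sup_left_of_disjoint_sup_right h1').exists_isCompl
  have h0 : ∀ x ∈ K, (φ ∘ₗ M.subtype ∘ₗ M.projectionOnto K hKM.symm) x = 0 := fun x hx => by
    rw [LinearMap.comp_apply, LinearMap.comp_apply,
      (Submodule.projectionOnto_apply_eq_zero_iff hKM.symm).mpr hx, map_zero, map_zero]
  refine ⟨φ ∘ₗ M.subtype ∘ₗ M.projectionOnto K hKM.symm, fun x hx => ?_, h0 _ (hK ?_),
    fun l => h0 _ (hK ?_)⟩
  · rw [LinearMap.comp_apply, LinearMap.comp_apply,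
      Submodule.projectionOnto_apply_of_mem_left hKM.symm hx]
    rfl
  · exact Submodule.mem_sup_left (Submodule.mem_span_singleton_self 1)
  · exact Submodule.mem_sup_right (Submodule.subset_span ⟨l, rfl⟩)

theorem mem_vars_iff_exists_coeff (g : MvPolynomial (Fin n) k) (l : Fin n) :
    l ∈ g.vars ↔ ∃ γ, g.coeff γ ≠ 0 ∧ γ l ≠ 0 := by
  rw [MvPolynomial.mem_vars_iff_mem_support]
  simp [MvPolynomial.mem_support_iff]

theorem coeff_componentsGE (d : ℕ) (g : MvPolynomial (Fin n) k) (γ : Fin n →₀ ℕ) :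
    (componentsGE d g).coeff γ = if d ≤ γ.degree then g.coeff γ else 0 := by
  rw [componentsGE, MvPolynomial.coeff_sum]
  simp only [MvPolynomial.coeff_homogeneousComponent]
  rw [Finset.sum_ite_eq]
  by_cases hd : d ≤ γ.degree
  · by_cases h : γ.degree ≤ g.totalDegree
    · rw [if_pos (Finset.mem_Icc.mpr ⟨hd, h⟩), if_pos hd]
    · rw [if_neg (fun h' => h (Finset.mem_Icc.mp h').2), if_pos hd]
      by_contra h0
      exact h (MvPolynomial.le_totalDegree (MvPolynomial.mem_support_iff.mpr (Ne.symm h0)))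
  · rw [if_neg (fun h' => hd (Finset.mem_Icc.mp h').1), if_neg hd]

theorem prod_pow_single {A : Type*} [CommRing A] (z : Fin n → A) (l : Fin n) :
    ∏ i, z i ^ (Finsupp.single l 1 : Fin n →₀ ℕ) i = z l := by
  rw [Finset.prod_eq_single l]
  · simp
  · intro i _ hi
    simp [hi.symm]
  · simp

/-- A monomial in elements of an ideal splits off each of its factors. -/
theorem exists_prod_pow_eq_mul {A : Type*} [CommRing A] {𝔪 : Ideal A} {z : Fin n → A}
    (hz : ∀ l, z l ∈ 𝔪) {γ : Fin n →₀ ℕ} {l : Fin n} (hl : γ l ≠ 0) :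
    ∃ y ∈ 𝔪 ^ (γ.degree - 1), ∏ i, z i ^ γ i = z l * y := by
  obtain ⟨β, rfl⟩ : ∃ β, γ = Finsupp.single l 1 + β :=
    le_iff_exists_add.mp (Finsupp.single_le_iff.mpr (Nat.one_le_iff_ne_zero.mpr hl))
  refine ⟨∏ i, z i ^ β i, ?_, ?_⟩
  · rw [map_add, Finsupp.degree_single, Nat.add_sub_cancel_left, Finsupp.degree_eq_sum,
      ← Finset.prod_pow_eq_pow_sum]
    exact Ideal.prod_mem_prod fun i _ => Ideal.pow_mem_pow (hz i) _
  · simp only [Finsupp.add_apply, pow_add, Finset.prod_mul_distrib]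
    rw [prod_pow_single]

theorem exists_eq_single_add_of_degree_eq_succ {γ : Fin n →₀ ℕ} {l : Fin n} (hl : γ l ≠ 0) {d : ℕ}
    (hd : γ.degree = d + 1) : ∃ β : Fin n →₀ ℕ, γ = Finsupp.single l 1 + β ∧ β.degree = d := by
  obtain ⟨β, rfl⟩ : ∃ β, γ = Finsupp.single l 1 + β :=
    le_iff_exists_add.mp (Finsupp.single_le_iff.mpr (Nat.one_le_iff_ne_zero.mpr hl))
  refine ⟨β, rfl, ?_⟩
  rw [map_add, Finsupp.degree_single] at hd
  omega

theorem exists_eq_single_of_degree_eq_one {γ : Fin n →₀ ℕ} (hd : γ.degree = 1) :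
    ∃ l, γ = Finsupp.single l 1 := by
  obtain ⟨l, hl⟩ : ∃ l, γ l ≠ 0 := by
    by_contra! h
    obtain rfl : γ = 0 := Finsupp.ext h
    simp at hd
  obtain ⟨β, rfl, hβ⟩ := exists_eq_single_add_of_degree_eq_succ hl hd
  rw [Finsupp.degree_eq_zero_iff] at hβ
  exact ⟨l, by rw [hβ, add_zero]⟩

theorem IsAdapted.surjective {A : Type*} [CommRing A] [Algebra k A] {φ : A →ₗ[k] k}
    {𝔪 : Ideal A} {e q N : ℕ} {z : Fin n → A} (hz : IsAdapted φ 𝔪 e q z) (hN : 𝔪 ^ N = ⊥)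
    (hres : ∀ x : A, ∃ c : k, x - algebraMap k A c ∈ 𝔪)
    (ψ : MvPowerSeries (Fin n) k →ₐ[k] A) (hX : ∀ i, ψ (MvPowerSeries.X i) = z i) :
    Function.Surjective ψ := by
  rw [← AlgHom.range_eq_top]
  refine subalgebra_eq_top_of_generates hN hres _ fun x hx => ?_
  obtain ⟨s, hs, hs'⟩ := hz.generates x hx
  refine ⟨s, ?_, ?_, hs'⟩
  · have : Submodule.span k (Set.range z) ≤ Subalgebra.toSubmodule ψ.range := by
      refine Submodule.span_le.mpr ?_
      rintro _ ⟨l, rfl⟩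
      exact ⟨MvPowerSeries.X l, hX l⟩
    exact this hs
  · have : Submodule.span k (Set.range z) ≤ 𝔪.restrictScalars k := by
      refine Submodule.span_le.mpr ?_
      rintro _ ⟨l, rfl⟩
      exact hz.mem l
    exact this hs

/-- If `z_l 𝔪² ≠ 0`, the variable `x_l` occurs in the dual polynomial in degree at least `3`. -/
theorem exists_coeff_dualPolynomial_ne_zero [CharZero k] {A : Type*} [CommRing A] [Algebra k A]
    {j : ℕ} {φ : A →ₗ[k] k} (hφ : ∀ x, (∀ a, φ (a * x) = 0) → x = 0) {𝔪 : Ideal A} (h𝔪 : 𝔪 ≠ ⊤)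
    {z : Fin n → A} (ψ : MvPowerSeries (Fin n) k →ₐ[k] A) (hX : ∀ i, ψ (MvPowerSeries.X i) = z i)
    (hψ : ∀ σ : MvPowerSeries (Fin n) k, (j : ℕ∞) < σ.order → ψ σ = 0)
    (hsurj : Function.Surjective ψ) {l : Fin n} (hl : ∃ y ∈ 𝔪 ^ 2, z l * y ≠ 0) :
    ∃ γ : Fin n →₀ ℕ, 3 ≤ γ.degree ∧ (dualPolynomial j φ z).coeff γ ≠ 0 ∧ γ l ≠ 0 := by
  by_contra! h
  have hlift : ∀ a ∈ 𝔪, ∃ σ : MvPowerSeries (Fin n) k, 1 ≤ σ.order ∧ ψ σ = a := by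
    intro a ha
    obtain ⟨σ, rfl⟩ := hsurj a
    refine ⟨σ, MvPowerSeries.one_le_order_iff_constCoeff_eq_zero.mpr ?_, rfl⟩
    by_contra h0
    have hu : IsUnit σ := MvPowerSeries.isUnit_iff_constantCoeff.mpr (isUnit_iff_ne_zero.mpr h0)
    exact h𝔪 (Ideal.eq_top_of_isUnit_mem _ ha (hu.map ψ))
  -- Lift `a`, `b` to `σ`, `τ` and pair `X_l σ τ` with the dual polynomial. Its order is at least
  -- `3`, so low degrees contribute nothing, and in higher degrees it is divisible by `X_l` while
  -- the polynomial is assumed free of `x_l`.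
  have key : ∀ a ∈ 𝔪, ∀ b ∈ 𝔪, φ (z l * (a * b)) = 0 := by
    intro a ha b hb
    obtain ⟨σ, hσ, rfl⟩ := hlift a ha
    obtain ⟨τ, hτ, rfl⟩ := hlift b hb
    rw [← hX, ← map_mul, ← map_mul, ← constantCoeff_contract_dualPolynomial φ ψ hX hψ,
      constantCoeff_contract]
    refine Finset.sum_eq_zero fun γ hγ => ?_
    by_cases hd : 3 ≤ γ.degree
    · have hγl : γ l = 0 := h γ hd (MvPolynomial.mem_support_iff.mp hγ)
      have : MvPowerSeries.coeff γ (MvPowerSeries.X l * (σ * τ)) = 0 :=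
        MvPowerSeries.X_dvd_iff.mp (dvd_mul_right _ _) γ hγl
      rw [this, zero_mul, mul_zero]
    · have hlt : ((γ.degree : ℕ) : ℕ∞) < (MvPowerSeries.X l * (σ * τ)).order := calc
        ((γ.degree : ℕ) : ℕ∞) < ((3 : ℕ) : ℕ∞) := by exact_mod_cast not_le.mp hd
        _ = 1 + (1 + 1) := by norm_num
        _ ≤ (MvPowerSeries.X l : MvPowerSeries (Fin n) k).order + (σ.order + τ.order) := by
          gcongr
          exact MvPowerSeries.one_le_order_iff_constCoeff_eq_zero.mpr
            (MvPowerSeries.constantCoeff_X l)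
        _ ≤ (MvPowerSeries.X l * (σ * τ)).order :=
          (add_le_add_right MvPowerSeries.le_order_mul _).trans MvPowerSeries.le_order_mul
      rw [MvPowerSeries.coeff_of_lt_order hlt, zero_mul, mul_zero]
  obtain ⟨y, hy, hne⟩ := hl
  refine hne (hφ _ fun a => ?_)
  rw [mul_left_comm]
  have hay : a * y ∈ 𝔪 * 𝔪 := by
    rw [← pow_two]
    exact Ideal.mul_mem_left _ a hy
  refine Submodule.mul_induction_on hay (fun b hb c hc => key b hb c hc) fun b c hb hc => ?_
  rw [mul_add, map_add, hb, hc, add_zero]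

end Existence

theorem coeff_sum_X_sq_single {k : Type*} [Field k] {n : ℕ} (W : Finset (Fin n)) (l : Fin n) :
    (∑ i ∈ W, (MvPolynomial.X i : MvPolynomial (Fin n) k) ^ 2).coeff
      (Finsupp.single l 1 + Finsupp.single l 1) = if l ∈ W then 1 else 0 := by
  rw [MvPolynomial.coeff_sum, ← Finsupp.single_add]
  simp [MvPolynomial.coeff_X_pow, Finsupp.single_left_inj]

theorem coeff_sum_X_sq_of_ne {k : Type*} [Field k] {n : ℕ} (W : Finset (Fin n)) {l l' : Fin n}
    (h : l ≠ l') : (∑ i ∈ W, (MvPolynomial.X i : MvPolynomial (Fin n) k) ^ 2).coeff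
      (Finsupp.single l 1 + Finsupp.single l' 1) = 0 := by
  rw [MvPolynomial.coeff_sum]
  refine Finset.sum_eq_zero fun i _ => ?_
  rw [MvPolynomial.coeff_X_pow, if_neg]
  intro hi
  have h1 := DFunLike.congr_fun hi l
  rw [Finsupp.add_apply, Finsupp.single_eq_same, Finsupp.single_eq_of_ne h] at h1
  by_cases hil : i = l
  · subst hil
    simp at h1
  · rw [Finsupp.single_eq_of_ne (Ne.symm hil)] at h1
    omega

/-- The maximal ideal is unique, so any isomorphism carries it along; the decomposition of `g` can
then be computed in the algebra of `f`. -/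
theorem apolarMax_algEquiv {k : Type*} [Field k] {n : ℕ} {f g : MvPolynomial (Fin n) k}
    (hf : f ≠ 0) (E : ApolarAlgebra f ≃ₐ[k] ApolarAlgebra g) :
    apolarMax g = (apolarMax f).map E := by
  have := apolar_isLocalRing hf
  rw [← eq_apolarMax_of_isMaximal _ (IsLocalRing.maximalIdeal.isMaximal (ApolarAlgebra f))]
  exact (eq_apolarMax_of_isMaximal _ (Ideal.map_isMaximal_of_equiv E)).symm

theorem ne_zero_of_algEquiv {k : Type*} [Field k] {n : ℕ} {f g : MvPolynomial (Fin n) k}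
    (hf : f ≠ 0) (E : ApolarAlgebra f ≃ₐ[k] ApolarAlgebra g) : g ≠ 0 := by
  rintro rfl
  have : Nontrivial (ApolarAlgebra f) := Ideal.Quotient.nontrivial_iff.mpr (perp_ne_top hf)
  have : Nontrivial (ApolarAlgebra (0 : MvPolynomial (Fin n) k)) := E.injective.nontrivial
  refine Ideal.Quotient.nontrivial_iff.mp this (Ideal.eq_top_iff_one _ |>.mpr ?_)
  exact map_zero (contract (1 : MvPowerSeries (Fin n) k))

/-! ### Coefficients of the dual polynomial for adapted generators. -/

section AdaptedDualPolynomial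

variable {k : Type*} [Field k] {n : ℕ} {A : Type*} [CommRing A] [Algebra k A]

theorem coeff_dualPolynomial_eq_zero (j : ℕ) {φ : A →ₗ[k] k} {z : Fin n → A} {γ : Fin n →₀ ℕ}
    (h : φ (∏ i, z i ^ γ i) = 0) : (dualPolynomial j φ z).coeff γ = 0 := by
  rw [coeff_dualPolynomial, h, zero_mul, ite_self]

theorem coeff_dualPolynomial_eq_zero_of_degree_lt_two (j : ℕ) {φ : A →ₗ[k] k} {z : Fin n → A}
    (h1 : φ 1 = 0) (hz : ∀ l, φ (z l) = 0) {γ : Fin n →₀ ℕ} (hγ : γ.degree < 2) :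
    (dualPolynomial j φ z).coeff γ = 0 := by
  refine coeff_dualPolynomial_eq_zero j ?_
  rcases Nat.lt_or_ge γ.degree 1 with h | h
  · rw [Nat.lt_one_iff, Finsupp.degree_eq_zero_iff] at h
    simpa [h] using h1
  · obtain ⟨l, rfl⟩ := exists_eq_single_of_degree_eq_one (γ := γ) (by omega)
    rw [prod_pow_single, hz]

/-- A monomial of degree `d` containing `z l` lies in `z l · 𝔪^(d-1)`. This turns annihilation
conditions on generators into absence of variables. -/
theorem coeff_dualPolynomial_eq_zero_of_mul (j : ℕ) (φ : A →ₗ[k] k) {𝔪 : Ideal A} {z : Fin n → A}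
    (hz : ∀ l, z l ∈ 𝔪) {γ : Fin n →₀ ℕ} {l : Fin n} (hl : γ l ≠ 0)
    (h : ∀ y ∈ 𝔪 ^ (γ.degree - 1), z l * y = 0) : (dualPolynomial j φ z).coeff γ = 0 := by
  obtain ⟨y, hy, hy'⟩ := exists_prod_pow_eq_mul hz hl
  exact coeff_dualPolynomial_eq_zero j (by rw [hy', h y hy, map_zero])

theorem mem_vars_homogeneousComponent {i : ℕ} {g : MvPolynomial (Fin n) k} {l : Fin n} :
    l ∈ (MvPolynomial.homogeneousComponent i g).vars ↔
      ∃ γ : Fin n →₀ ℕ, γ.degree = i ∧ g.coeff γ ≠ 0 ∧ γ l ≠ 0 := by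
  rw [mem_vars_iff_exists_coeff]
  simp only [MvPolynomial.coeff_homogeneousComponent, ne_eq, ite_eq_right_iff, Classical.not_imp,
    and_assoc]

theorem mem_vars_componentsGE {d : ℕ} {g : MvPolynomial (Fin n) k} {l : Fin n} :
    l ∈ (componentsGE d g).vars ↔
      ∃ γ : Fin n →₀ ℕ, d ≤ γ.degree ∧ g.coeff γ ≠ 0 ∧ γ l ≠ 0 := by
  rw [mem_vars_iff_exists_coeff]
  simp only [coeff_componentsGE, ne_eq, ite_eq_right_iff, Classical.not_imp, and_assoc]

theorem exists_finset_card_eq {e q : ℕ} (h : e + q ≤ n) :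
    ∃ W : Finset (Fin n), W.card = q ∧ ∀ l : Fin n, l ∈ W ↔ e ≤ (l : ℕ) ∧ (l : ℕ) < e + q := by
  classical
  let W : Finset (Fin n) := Finset.univ.filter fun l => e ≤ (l : ℕ) ∧ (l : ℕ) < e + q
  have hW : ∀ l : Fin n, l ∈ W ↔ e ≤ (l : ℕ) ∧ (l : ℕ) < e + q := fun l => by simp [W]
  refine ⟨W, ?_, hW⟩
  have h1 : W.map Fin.valEmbedding = Finset.Ico e (e + q) := by
    ext i
    simp only [Finset.mem_map, hW, Fin.valEmbedding_apply, Finset.mem_Ico]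
    refine ⟨?_, fun hi => ⟨⟨i, by omega⟩, hi, rfl⟩⟩
    rintro ⟨l, hl, rfl⟩
    exact hl
  rw [← Finset.card_map Fin.valEmbedding, h1, Nat.card_Ico, Nat.add_sub_cancel_left]

/-- The quadratic part of the dual polynomial with respect to adapted generators. -/
theorem IsAdapted.coeff_two [CharZero k] {φ φ' : A →ₗ[k] k} {𝔪 : Ideal A} {e q : ℕ}
    {z : Fin n → A} (hz : IsAdapted φ 𝔪 e q z) (hφ : ∀ x ∈ 𝔪 ^ 2, φ' x = φ x) {j : ℕ} (hj : 2 ≤ j)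
    {W : Finset (Fin n)} (hW : ∀ l : Fin n, l ∈ W ↔ e ≤ (l : ℕ) ∧ (l : ℕ) < e + q)
    {γ : Fin n →₀ ℕ} (hd : γ.degree = 2) {l : Fin n} (hl : e ≤ l) (hγl : γ l ≠ 0) :
    (dualPolynomial j φ' z).coeff γ =
      (∑ i ∈ W, (MvPolynomial.X i : MvPolynomial (Fin n) k) ^ 2).coeff γ := by
  obtain ⟨β, rfl, hβ⟩ := exists_eq_single_add_of_degree_eq_succ hγl hd
  obtain ⟨l', rfl⟩ := exists_eq_single_of_degree_eq_one hβ
  have hprod : ∏ i, z i ^ (Finsupp.single l 1 + Finsupp.single l' 1 : Fin n →₀ ℕ) i =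
      z l * z l' := by
    simp only [Finsupp.add_apply, pow_add, Finset.prod_mul_distrib, prod_pow_single]
  have hφφ : φ' (z l * z l') = φ (z l * z l') :=
    hφ _ (by rw [pow_two]; exact Ideal.mul_mem_mul (hz.mem l) (hz.mem l'))
  by_cases hll : l = l'
  · subst hll
    rw [coeff_sum_X_sq_single]
    by_cases hlq : (l : ℕ) < e + q
    · rw [if_pos ((hW l).mpr ⟨hl, hlq⟩),
        coeff_dualPolynomial, if_pos (by omega), hprod, hφφ, hz.norm l hl hlq,
        Finset.prod_eq_single l (fun i _ hi => by simp [hi.symm]) (by simp)]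
      simp
    · rw [if_neg fun h => hlq ((hW l).mp h).2]
      exact coeff_dualPolynomial_eq_zero j (by
        rw [hprod, hz.eq_zero l (by omega), zero_mul, map_zero])
  · rw [coeff_sum_X_sq_of_ne _ hll]
    exact coeff_dualPolynomial_eq_zero j (by rw [hprod, hφφ, hz.orthogonal l l' hl hll])

/-- For adapted generators, the quadratic part of the dual polynomial is a sum of squares of
variables that occur in no higher degree and a form in the variables that do. -/
theorem IsAdapted.exists_quadratic_part [CharZero k] {φ φ' : A →ₗ[k] k} {𝔪 : Ideal A} {e q : ℕ}
    {z : Fin n → A} (hz : IsAdapted φ 𝔪 e q z) (hφ : ∀ x ∈ 𝔪 ^ 2, φ' x = φ x) {j : ℕ} (hj : 2 ≤ j)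
    (hen : e + q ≤ n)
    (hvars : ∀ l : Fin n, (l : ℕ) < e → l ∈ (componentsGE 3 (dualPolynomial j φ' z)).vars) :
    ∃ (W : Finset (Fin n)) (Q : MvPolynomial (Fin n) k),
      W.card = q ∧
      Disjoint W (componentsGE 3 (dualPolynomial j φ' z)).vars ∧
      Q.IsHomogeneous 2 ∧
      Q.vars ⊆ (componentsGE 3 (dualPolynomial j φ' z)).vars ∧
      MvPolynomial.homogeneousComponent 2 (dualPolynomial j φ' z) =
        ∑ i ∈ W, MvPolynomial.X i ^ 2 + Q := by
  obtain ⟨W, hWq, hW⟩ := exists_finset_card_eq hen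
  have hhom : (∑ i ∈ W, (MvPolynomial.X i : MvPolynomial (Fin n) k) ^ 2).IsHomogeneous 2 :=
    MvPolynomial.IsHomogeneous.sum _ _ _ fun l _ => by
      simpa using (MvPolynomial.isHomogeneous_X k l).pow 2
  have hQ := (MvPolynomial.homogeneousComponent_isHomogeneous 2 (dualPolynomial j φ' z)).sub hhom
  refine ⟨W, MvPolynomial.homogeneousComponent 2 (dualPolynomial j φ' z) -
    ∑ i ∈ W, MvPolynomial.X i ^ 2, hWq, ?_, hQ, ?_, (add_sub_cancel _ _).symm⟩
  · rw [Finset.disjoint_left]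
    intro l hl hl'
    obtain ⟨γ, hγ3, hγg, hγl⟩ := mem_vars_componentsGE.mp hl'
    refine hγg (coeff_dualPolynomial_eq_zero_of_mul j φ' hz.mem hγl fun y hy => ?_)
    exact hz.mul_eq_zero l ((hW l).mp hl).1 y (Ideal.pow_le_pow_right (by omega) hy)
  · intro l hl
    refine hvars l ?_
    obtain ⟨γ, hγ, hγl⟩ := (mem_vars_iff_exists_coeff _ l).mp hl
    have hd : γ.degree = 2 := by
      by_contra h
      exact hγ (hQ.coeff_eq_zero h)
    by_contra hle
    refine hγ ?_
    rw [MvPolynomial.coeff_sub, MvPolynomial.coeff_homogeneousComponent, if_pos hd,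
      hz.coeff_two hφ hj hW hd (not_lt.mp hle) hγl, sub_self]

end AdaptedDualPolynomial

end Apolarity

/-! ### Assembly of the normal form. -/

theorem mainTheorem5 (n j q : ℕ) (hj : 2 ≤ j) (f : MvPolynomial (Fin n) ℂ)
    (hf : f.totalDegree = j) (hq : Apolarity.apolarDecomp f (j - 2) 1 = q) :
    ∃ g : MvPolynomial (Fin n) ℂ,
      Nonempty (Apolarity.ApolarAlgebra f ≃ₐ[ℂ] Apolarity.ApolarAlgebra g) ∧
      g.totalDegree = j ∧
      Apolarity.IsStandardForm g ∧
      g = ∑ i ∈ Finset.Icc 2 j, MvPolynomial.homogeneousComponent i g ∧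
      ∃ (W : Finset (Fin n)) (Q : MvPolynomial (Fin n) ℂ),
        W.card = q ∧
        Disjoint W (Apolarity.componentsGE 3 g).vars ∧
        Q.IsHomogeneous 2 ∧
        Q.vars ⊆ (Apolarity.componentsGE 3 g).vars ∧
        MvPolynomial.homogeneousComponent 2 g = ∑ i ∈ W, MvPolynomial.X i ^ 2 + Q := by
  open Apolarity in
  have hf0 : f ≠ 0 := by
    rintro rfl
    rw [MvPolynomial.totalDegree_zero] at hf
    omega
  have := apolar_isLocalRing hf0
  set 𝔪 := apolarMax f with h𝔪
  have hmax : IsLocalRing.maximalIdeal (ApolarAlgebra f) = 𝔪 :=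
    eq_apolarMax_of_isMaximal _ (IsLocalRing.maximalIdeal.isMaximal _)
  have hunit : ∀ x ∉ 𝔪, IsUnit x := fun x hx => by
    rw [← hmax] at hx
    exact IsLocalRing.notMem_maximalIdeal.mp hx
  have htop : 𝔪 ≠ ⊤ := hmax ▸ (IsLocalRing.maximalIdeal.isMaximal _).ne_top
  have hjm : 𝔪 ^ (j + 1) = ⊥ := hf ▸ apolarMax_pow_succ_totalDegree f
  have hjne : 𝔪 ^ j ≠ ⊥ := hf ▸ apolarMax_pow_totalDegree_ne_bot hf0
  have h2 : 𝔪 ^ 2 ≠ ⊥ := fun h => hjne (le_bot_iff.mp (h ▸ Ideal.pow_le_pow_right hj))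
  have hsoc : socleDegree 𝔪 = j := socleDegree_eq hjm hjne
  -- With `s = j - 2` and `t = 1` the second index `j + 1 - (s + t)` equals `2`.
  have hqr : rankQ ℂ 𝔪 1 2 = q := by
    rw [← hq, apolarDecomp, hilbertDecomp, ← h𝔪, hsoc, if_pos (by omega)]
    congr 1
    omega
  obtain ⟨e, z, hen, hz⟩ := exists_isAdapted (apolarFunctional_nondegenerate f) hunit h2 hj hjm
    (finrank_apolarMax_le f)
  rw [hqr] at hen hz
  obtain ⟨φ, hφ2, hφ1, hφz⟩ := hz.exists_functional ((Ideal.ne_top_iff_one 𝔪).mp htop)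
  have hφ := nondegenerate_of_eqOn_sq (apolarFunctional_nondegenerate f) hunit h2 hjm hφ2
  obtain ⟨ψ, hX, hψ⟩ := exists_algHom_apolarAlgebra f hz.mem
  rw [hf] at hψ
  have hsurj := hz.surjective hjm (exists_sub_algebraMap_mem_apolarMax f) ψ hX
  obtain ⟨E⟩ := nonempty_algEquiv_dualPolynomial hφ ψ hX hψ hsurj
  set g := dualPolynomial j φ z with hg
  have hmg : apolarMax g = 𝔪.map E := apolarMax_algEquiv hf0 E
  have hsocg : socleDegree (apolarMax g) = j := by rw [hmg, socleDegree_map, hsoc]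
  -- The degree of a nonzero polynomial is the socle degree of its apolar algebra, an isomorphism
  -- invariant.
  have hdeg : g.totalDegree = j := by
    have hg0 := ne_zero_of_algEquiv hf0 E
    rw [← hsocg]
    exact (socleDegree_eq (apolarMax_pow_succ_totalDegree g)
      (apolarMax_pow_totalDegree_ne_bot hg0)).symm
  -- `e(j - i)` is the codimension of the image of `(0 : 𝔪^(i-1))` in `𝔪/𝔪²`, exactly the threshold
  -- in `mul_eq_zero_of_le` for `b = i - 1`.
  have hemb : ∀ i, 2 ≤ i → i ≤ j → embCount ℂ 𝔪 (j - i) +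
      Module.finrank ℂ ↥(loewyIdeal 𝔪 1 (i - 1) ⊔ 𝔪 ^ 2) = Module.finrank ℂ 𝔪 := by
    intro i hi hij
    have h := embCount_add_finrank (k := ℂ) 𝔪 (i := j - i) (by omega)
    rw [hsoc, loewyIdeal_one_eq hjm, sup_eq_left.mpr (Ideal.pow_le_self two_ne_zero : 𝔪 ^ 2 ≤ 𝔪)] at h
    have h1 : j - (j - i + 1) = i - 1 := by omega
    rwa [h1] at h
  have hlow : ∀ γ : Fin n →₀ ℕ, γ.degree < 2 → g.coeff γ = 0 := fun γ hγ =>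
    coeff_dualPolynomial_eq_zero_of_degree_lt_two j hφ1 hφz hγ
  have hcomp : ∀ i < 2, MvPolynomial.homogeneousComponent i g = 0 := by
    intro i hi
    ext γ
    rw [MvPolynomial.coeff_homogeneousComponent, MvPolynomial.coeff_zero]
    split_ifs with h
    · exact hlow γ (by omega)
    · rfl
  refine ⟨g, ⟨E⟩, hdeg, ⟨by rw [hdeg, hsocg], ?_, Or.inr ⟨hcomp 0 two_pos, hcomp 1 one_lt_two⟩⟩, ?_,
    hz.exists_quadratic_part hφ2 hj hen fun l hl => mem_vars_componentsGE.mpr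
      (exists_coeff_dualPolynomial_ne_zero hφ htop ψ hX hψ hsurj (hz.exists_mul_ne_zero l hl))⟩
  · intro i hi l hl
    rw [hsocg] at hi ⊢
    rw [hmg, embCount_map]
    obtain ⟨γ, hγi, hγg, hγl⟩ := mem_vars_homogeneousComponent.mp hl
    have hi2 : 2 ≤ i := by
      by_contra h
      exact hγg (hlow γ (by omega))
    by_contra hlt
    have := hemb i hi2 hi
    refine hγg (coeff_dualPolynomial_eq_zero_of_mul j φ hz.mem hγl ?_)
    rw [hγi]
    exact hz.mul_eq_zero_of_le (i - 1) (by omega) l (by omega)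
  · ext γ
    rw [MvPolynomial.coeff_sum]
    simp only [MvPolynomial.coeff_homogeneousComponent]
    rw [Finset.sum_ite_eq]
    split_ifs with h
    · rfl
    · rw [Finset.mem_Icc, not_and_or, not_le, not_le] at h
      refine h.elim (hlow γ) fun hγ => ?_
      rw [hg, coeff_dualPolynomial, if_neg (by omega)]
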